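/- Let $\mathcal G_d=(\mathcal V,\mathcal E)$ be an undirected graph with countably infinite vertex and edge sets which is connected, locally finite (every vertex has finitely many incident edges) and simple (no loops or multiple edges), and let each edge $e\in\mathcal E$ be given a length $|e|\in(0,\infty)$. Let $\mathcal G$ be the resulting metric graph: each edge $e$ is identified with the interval $[0,|e|]$ (after choosing a direction), and endpoints of edges corresponding to the same vertex are glued together; $\mathcal G$ carries the natural topology and $\mathrm{vol}$ denotes its Lebesgue measure. For $f:\mathcal G\to\mathbb C$ let $f_e$ be the restriction of $f$ to $e$, and put $\|f\|_{L^2(\mathcal G)}^2=\sum_{e}\|f_e\|_{L^2(e)}^2$ and $\|f'\|_{L^2(\mathcal G)}^2=\sum_{e}\|f_e'\|_{L^2(e)}^2$. Let $H^1(\mathcal G)$ be the space of continuous functions $f:\mathcal G\to\mathbb C$ with $f_e\in H^1(e)$ for all $e\in\mathcal E$ (that is, $f_e$ is absolutely continuous with $f_e'\in L^2(e)$), $\|f\|_{L^2(\mathcal G)}<\infty$ and $\|f'\|_{L^2(\mathcal G)}<\infty$, with the norm $\|f\|_{H^1(\mathcal G)}^2=\|f\|_{L^2(\mathcal G)}^2+\|f'\|_{L^2(\mathcal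 G)}^2$. Let $D$ be the space of continuous functions $f:\mathcal G\to\mathbb C$ that are non-zero only on finitely many edges, satisfy $f_e\in H^2(e)$ (that is, $f_e,f_e'\in H^1(e)$) for all $e\in\mathcal E$, and satisfy the Kirchhoff condition $\sum_{e\ni v}f_e'(v)=0$ at every vertex $v$, where $f_e'(v)$ is the derivative of $f_e$ at $v$ in the direction pointing from $v$ into $e$. Let $H^1_0(\mathcal G)$ be the closure of $D$ in $H^1(\mathcal G)$ with respect to $\|\cdot\|_{H^1(\mathcal G)}$. A topological end of $\mathcal G$ is an equivalence class of sequences $(U_n)_{n\ge0}$ of non-empty open connected subsets of $\mathcal G$ with compact boundaries such that $U_{n+1}\subseteq U_n$ for all $n$ and $\bigcap_n\overline{U_n}=\emptyset$, where $(U_n)$ and $(U_n')$ are equivalent if for every $n$ there are $j,k$ with $U'_j\subseteq U_n$ and $U_k\subseteq U'_n$. A topological end has finite volume if it is represented by some sequence $(U_n)$ such that $\mathrm{vol}(U_n)<\infty$ for some $n$; otherwise it has infinite volume. Then $H^1(\mathcal G)=H^1_0(\mathcal G)$ if and only if all topological ends of $\mathcal G$ have infinite volume. -/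

import Mathlib

open Set Filter Topology MeasureTheory
open scoped ENNReal

noncomputable section

/-- A metric graph over a vertex set `V`: a connected, locally finite, simple graph together with
a length in `(0, ∞)` for each edge and a choice of a direction for each edge (the direction only
serves to identify the edge with the interval `[0, length e]`). -/
structure MetricGraph (V : Type*) where
  /-- the underlying combinatorial graph -/
  graph : SimpleGraph V
  connected : graph.Connected
  /-- every vertex has finitely many incident edges -/
  locallyFinite : ∀ v : V, {e : graph.edgeSet | v ∈ (e : Sym2 V)}.Finite
  /-- the initial vertex of an edge -/
  src : graph.edgeSet → V
  /-- the terminal vertex of an edge -/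
  tgt : graph.edgeSet → V
  mk_src_tgt : ∀ e : graph.edgeSet, s(src e, tgt e) = (e : Sym2 V)
  /-- the edge lengths -/
  length : graph.edgeSet → ℝ
  length_pos : ∀ e, 0 < length e

namespace MetricGraph

variable {V : Type*} (Γ : MetricGraph V)

/-- The edges of a metric graph. -/
abbrev Edge : Type _ := Γ.graph.edgeSet

/-- The points of a metric graph: the vertices, and the interior points of the edges. This is the
disjoint union of the intervals `[0, length e]` in which endpoints belonging to the same vertex
are identified. -/
inductive Point : Type _
  | vertex (v : V) : Point
  | inner (e : Γ.Edge) (t : ℝ) (ht : t ∈ Ioo 0 (Γ.length e)) : Point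

/-- The parametrization `[0, length e] → Γ` of the edge `e`, from its initial to its terminal
vertex; it is extended to all of `ℝ` by being constant outside `[0, length e]`. -/
def param (e : Γ.Edge) (t : ℝ) : Γ.Point :=
  if h₀ : t ≤ 0 then Point.vertex (Γ.src e)
  else if h₁ : Γ.length e ≤ t then Point.vertex (Γ.tgt e)
  else Point.inner e t ⟨not_le.mp h₀, not_le.mp h₁⟩

/-- The natural topology: the quotient topology of the disjoint union of the intervals
`[0, length e]`, that is, `U` is open iff its preimage in `[0, length e]` is open for all `e`. -/
instance : TopologicalSpace Γ.Point :=
  ⨆ e : Γ.Edge, TopologicalSpace.coinduced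
    (fun t : Icc (0 : ℝ) (Γ.length e) => Γ.param e t) inferInstance

/-- The Lebesgue measure of a (measurable) set `A ⊆ Γ`. -/
def vol (A : Set Γ.Point) : ℝ≥0∞ :=
  ∑' e : Γ.Edge, volume {t : ℝ | t ∈ Icc 0 (Γ.length e) ∧ Γ.param e t ∈ A}

/-! ### Topological ends -/

/-- Decreasing sequences of non-empty open connected sets with compact boundaries whose closures
have empty intersection. -/
structure EndSeq where
  /-- the `n`-th set of the sequence -/
  set : ℕ → Set Γ.Point
  isOpen : ∀ n, IsOpen (set n)
  /-- connected, and in particular non-empty -/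
  isConnected : ∀ n, IsConnected (set n)
  isCompact_frontier : ∀ n, IsCompact (frontier (set n))
  subset : ∀ n, set (n + 1) ⊆ set n
  iInter_closure : ⋂ n, closure (set n) = ∅

/-- Two sequences are equivalent if each set of either contains some set of the other. -/
instance EndSeq.setoid : Setoid Γ.EndSeq where
  r U U' := ∀ n, (∃ j, U'.set j ⊆ U.set n) ∧ (∃ k, U.set k ⊆ U'.set n)
  iseqv :=
    { refl := fun _ n => ⟨⟨n, Subset.rfl⟩, ⟨n, Subset.rfl⟩⟩
      symm := fun h n => ⟨(h n).2, (h n).1⟩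
      trans := fun {U U' U''} h h' n => by
        obtain ⟨j, hj⟩ := (h n).1
        obtain ⟨k, hk⟩ := (h' j).1
        obtain ⟨j', hj'⟩ := (h' n).2
        obtain ⟨k', hk'⟩ := (h j').2
        exact ⟨⟨k, hk.trans hj⟩, ⟨k', hk'.trans hj'⟩⟩ }

/-- The topological ends of `Γ`. -/
def TopEnd : Type _ := Quotient (EndSeq.setoid Γ)

variable {Γ} in
/-- The end `γ` has finite volume: for some sequence `U` representing `γ`, some `U n` has finite
volume. -/
def TopEnd.HasFiniteVolume (γ : Γ.TopEnd) : Prop :=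
  ∃ U : Γ.EndSeq, Quotient.mk (EndSeq.setoid Γ) U = γ ∧ ∃ n, Γ.vol (U.set n) < ∞

variable {Γ} in
/-- The end `γ` has infinite volume if it does not have finite volume. -/
def TopEnd.HasInfiniteVolume (γ : Γ.TopEnd) : Prop := ¬ γ.HasFiniteVolume

/-! ### Sobolev spaces on an interval -/

/-- The Sobolev space `H¹(0, L)`: the absolutely continuous functions on `[0, L]` whose
(almost everywhere defined) derivative is square integrable. -/
def IntervalH1 (L : ℝ) (f : ℝ → ℂ) : Prop :=
  AbsolutelyContinuousOnInterval f 0 L ∧ MemLp (deriv f) 2 (volume.restrict (Ioo 0 L))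

/-- The Sobolev space `H²(0, L)`: the functions in `H¹(0, L)` whose derivative is in `H¹(0, L)`
(that is, it agrees almost everywhere with a function as in `IntervalH1`). -/
def IntervalH2 (L : ℝ) (f : ℝ → ℂ) : Prop :=
  IntervalH1 L f ∧ ∃ g : ℝ → ℂ, IntervalH1 L g ∧ deriv f =ᵐ[volume.restrict (Ioo 0 L)] g

/-! ### Function spaces on the metric graph -/

/-- The restriction `f_e` of `f` to the edge `e`, as a function of the parameter. -/
def onEdge (f : Γ.Point → ℂ) (e : Γ.Edge) (t : ℝ) : ℂ := f (Γ.param e t)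

/-- `‖f‖²` in `L²(Γ)`, the sum over all edges `e` of the squared norm of `f_e` in `L²(e)`. -/
def l2NormSq (f : Γ.Point → ℂ) : ℝ≥0∞ :=
  ∑' e : Γ.Edge, ∫⁻ t in Ioo 0 (Γ.length e), ‖Γ.onEdge f e t‖ₑ ^ 2

/-- `‖f'‖²` in `L²(Γ)`, the sum over all edges `e` of the squared norm of `f_e'` in `L²(e)`. -/
def energy (f : Γ.Point → ℂ) : ℝ≥0∞ :=
  ∑' e : Γ.Edge, ∫⁻ t in Ioo 0 (Γ.length e), ‖deriv (Γ.onEdge f e) t‖ₑ ^ 2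

/-- The norm of `H¹(Γ)`. -/
def h1Norm (f : Γ.Point → ℂ) : ℝ≥0∞ := (Γ.l2NormSq f + Γ.energy f) ^ (1 / 2 : ℝ)

/-- The Sobolev space `H¹(Γ)`: the continuous functions `f` in `L²(Γ)` such that `f_e ∈ H¹(e)` for
all edges `e` and `‖f'‖² < ∞`. -/
def H1 : Set (Γ.Point → ℂ) :=
  {f | Continuous f ∧ Γ.l2NormSq f < ∞ ∧ (∀ e, IntervalH1 (Γ.length e) (Γ.onEdge f e)) ∧
    Γ.energy f < ∞}

open Classical in
/-- The derivative `f_e'(v)` of `f` along the edge `e` at its endpoint `v`, in the direction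
pointing from `v` into the edge. -/
def outwardDeriv (f : Γ.Point → ℂ) (e : Γ.Edge) (v : V) : ℂ :=
  if Γ.src e = v then derivWithin (Γ.onEdge f e) (Icc 0 (Γ.length e)) 0
  else -derivWithin (Γ.onEdge f e) (Icc 0 (Γ.length e)) (Γ.length e)

/-- The domain of the pre-minimal Kirchhoff Laplacian: the functions `f` with `f_e ∈ H²(e)` for
every edge `e` that are non-zero only on finitely many edges and satisfy the Kirchhoff conditions
(`f` is continuous, and the outward derivatives sum to zero at each vertex). -/
def domPreminimal : Set (Γ.Point → ℂ) :=
  {f | (∀ e, IntervalH2 (Γ.length e) (Γ.onEdge f e)) ∧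
    {e : Γ.Edge | ∃ t ∈ Icc 0 (Γ.length e), Γ.onEdge f e t ≠ 0}.Finite ∧
    Continuous f ∧ ∀ v : V, ∑ e ∈ (Γ.locallyFinite v).toFinset, Γ.outwardDeriv f e v = 0}

/-- The space `H¹₀(Γ)`: the closure in `H¹(Γ)` of the domain of the pre-minimal Kirchhoff
Laplacian, with respect to the norm of `H¹(Γ)`. -/
def H10 : Set (Γ.Point → ℂ) :=
  {f | f ∈ Γ.H1 ∧ ∀ ε : ℝ≥0∞, 0 < ε → ∃ g ∈ Γ.domPreminimal, Γ.h1Norm (f - g) < ε}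

end MetricGraph

end

noncomputable section

namespace MetricGraph

/-! ### Absolutely continuous functions on an interval -/

/-! Everything rests on one inequality, `edist_norm_sq_le_sobolevSq`: since |(|f|²)'| ≤ 2|f||f'| ≤
|f|² + |f'|², the function |f|² oscillates on an edge by at most the squared H¹ norm of f on that
edge, however short or long the edge is. Summed along a path (`edist_le_tsum_of_reachable`), it
bounds the oscillation of |f|² on a connected subgraph.

An end of finite volume obstructs density. Some U_n in a representing sequence has finite volume, so
the function f that is 1 on the edges inside U_n, 0 on those outside and affine on the finitely many
edges meeting its boundary lies in H¹ (`affineIndicator_mem_H1`). It equals 1 at infinitely many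
vertices, while any g in D vanishes at all but finitely many. Hence |f - g| = 1 at some vertex, and
a small norm of f - g would keep |f - g|² ≥ 1/2 on a fixed edge, which is absurd
(`notMem_H10_of_infinite_vertices`).

Conversely, if all ends have infinite volume, H¹ functions vanish at infinity
(`finite_edges_norm_sq_ge`): points with |f|² ≥ c on infinitely many edges would accumulate at an
end, near which the remaining norm is so small that |f|² ≥ c/4 throughout, forcing finite volume.
Now `truncate r ∘ f` tends to 0 in H¹ as r → 0, and f - `truncate r ∘ f` lives on finitely many
edges. Smoothing it edge by edge, with the vertex values kept and zero derivatives at the endpoints,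
gives an element of D. -/

lemma _root_.LipschitzWith.comp_absolutelyContinuousOnInterval {X Y : Type*}
    [PseudoMetricSpace X] [PseudoMetricSpace Y] {φ : X → Y} {K : NNReal} (hφ : LipschitzWith K φ)
    {f : ℝ → X} {a b : ℝ} (hf : AbsolutelyContinuousOnInterval f a b) :
    AbsolutelyContinuousOnInterval (φ ∘ f) a b := by
  refine squeeze_zero (fun t => Finset.sum_nonneg fun i _ => dist_nonneg) (fun t => ?_)
    (by simpa using Tendsto.const_mul (K : ℝ) hf)
  rw [Finset.mul_sum]
  exact Finset.sum_le_sum fun i _ => hφ.dist_le_mul _ _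

lemma _root_.AbsolutelyContinuousOnInterval.congr {X : Type*} [PseudoMetricSpace X]
    {f g : ℝ → X} {a b : ℝ} (hf : AbsolutelyContinuousOnInterval f a b)
    (h : EqOn f g (uIcc a b)) : AbsolutelyContinuousOnInterval g a b := by
  refine Tendsto.congr' ?_ hf
  filter_upwards [mem_inf_of_right (mem_principal_self _)] with E hE
  refine Finset.sum_congr rfl fun i hi => ?_
  rw [h (hE.1 i hi).1, h (hE.1 i hi).2]

lemma _root_.AbsolutelyContinuousOnInterval.ae_differentiableAt_restrict {f : ℝ → ℂ} {L : ℝ}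
    (hL : 0 ≤ L) (hf : AbsolutelyContinuousOnInterval f 0 L) :
    ∀ᵐ t ∂volume.restrict (Ioo 0 L), DifferentiableAt ℝ f t := by
  rw [ae_restrict_iff' measurableSet_Ioo]
  filter_upwards [hf.boundedVariationOn.ae_differentiableAt_of_mem_uIcc] with t ht h
  exact ht (by rw [uIcc_of_le hL]; exact Ioo_subset_Icc_self h)

/-- The squared norm of `H¹(0, L)`. -/
def sobolevSq (L : ℝ) (f : ℝ → ℂ) : ℝ≥0∞ :=
  ∫⁻ t in Ioo 0 L, (‖f t‖ₑ ^ 2 + ‖deriv f t‖ₑ ^ 2)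

lemma sobolevSq_eq_add (L : ℝ) (f : ℝ → ℂ) :
    sobolevSq L f = (∫⁻ t in Ioo 0 L, ‖f t‖ₑ ^ 2) + ∫⁻ t in Ioo 0 L, ‖deriv f t‖ₑ ^ 2 :=
  lintegral_add_right _ ((measurable_deriv f).enorm.pow_const 2)

lemma deriv_eq_of_eqOn_Ioo {L : ℝ} {f g : ℝ → ℂ} (h : EqOn f g (Ioo 0 L)) :
    EqOn (deriv f) (deriv g) (Ioo 0 L) := fun _ ht =>
  (h.eventuallyEq_of_mem (isOpen_Ioo.mem_nhds ht)).deriv_eq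

lemma sobolevSq_congr {L : ℝ} {f g : ℝ → ℂ} (h : EqOn f g (Ioo 0 L)) :
    sobolevSq L f = sobolevSq L g := by
  refine setLIntegral_congr_fun measurableSet_Ioo fun t ht => ?_
  simp only [h ht, deriv_eq_of_eqOn_Ioo h ht]

lemma IntervalH1.congr {L : ℝ} (hL : 0 ≤ L) {f g : ℝ → ℂ} (hf : IntervalH1 L f)
    (h : EqOn f g (Icc 0 L)) : IntervalH1 L g := by
  refine ⟨hf.1.congr (by rwa [uIcc_of_le hL]), (memLp_congr_ae ?_).1 hf.2⟩
  filter_upwards [ae_restrict_mem measurableSet_Ioo] with t ht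
  exact deriv_eq_of_eqOn_Ioo (h.mono Ioo_subset_Icc_self) ht

lemma IntervalH2.congr {L : ℝ} (hL : 0 ≤ L) {f g : ℝ → ℂ} (hf : IntervalH2 L f)
    (h : EqOn f g (Icc 0 L)) : IntervalH2 L g := by
  obtain ⟨h1, u, hu, hfu⟩ := hf
  refine ⟨h1.congr hL h, u, hu, ?_⟩
  filter_upwards [hfu, ae_restrict_mem measurableSet_Ioo] with t h't ht
  rw [← h't, deriv_eq_of_eqOn_Ioo (h.mono Ioo_subset_Icc_self) ht]

lemma intervalH1_of_contDiff {L : ℝ} {f : ℝ → ℂ} (hf : ContDiff ℝ 1 f) : IntervalH1 L f := by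
  refine ⟨hf.contDiffOn.absolutelyContinuousOnInterval, ?_⟩
  have hc : Continuous (deriv f) := hf.continuous_deriv le_rfl
  obtain ⟨C, hC⟩ := isCompact_Icc.exists_bound_of_continuousOn (s := Icc 0 L) hc.continuousOn
  refine MemLp.of_bound hc.aestronglyMeasurable C ?_
  filter_upwards [ae_restrict_mem measurableSet_Ioo] with t ht
  exact hC t (Ioo_subset_Icc_self ht)

lemma intervalH2_of_contDiff {L : ℝ} {f : ℝ → ℂ} (hf : ContDiff ℝ 2 f) : IntervalH2 L f := by
  refine ⟨intervalH1_of_contDiff (hf.of_le (by norm_num)), deriv f, ?_, ae_eq_rfl⟩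
  refine intervalH1_of_contDiff ?_
  have : ContDiff ℝ (1 + 1) f := by simpa [one_add_one_eq_two] using hf
  exact (contDiff_succ_iff_deriv.1 this).2.2

lemma IntervalH1.lintegral_lt_top {L : ℝ} {f : ℝ → ℂ} (hf : IntervalH1 L f) :
    ∫⁻ t in Ioo 0 L, ‖deriv f t‖ₑ ^ 2 < ∞ := by
  have := (eLpNorm_lt_top_iff_lintegral_rpow_enorm_lt_top (by norm_num) (by norm_num)).1 hf.2.2
  simpa using this

lemma IntervalH1.sobolevSq_lt_top {L : ℝ} (hL : 0 ≤ L) {f : ℝ → ℂ} (hf : IntervalH1 L f) :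
    sobolevSq L f < ∞ := by
  rw [sobolevSq_eq_add]
  refine ENNReal.add_lt_top.2 ⟨?_, hf.lintegral_lt_top⟩
  obtain ⟨C, hC⟩ := hf.1.exists_bound
  rw [uIcc_of_le hL] at hC
  refine (setLIntegral_mono' measurableSet_Ioo (g := fun _ => ENNReal.ofReal C ^ 2)
    fun t ht => ?_).trans_lt ?_
  · gcongr
    rw [← ofReal_norm]
    exact ENNReal.ofReal_le_ofReal (hC t (Ioo_subset_Icc_self ht))
  · simp [ENNReal.mul_lt_top_iff]

lemma sq_enorm_add_le (a b : ℂ) : ‖a + b‖ₑ ^ 2 ≤ 2 * (‖a‖ₑ ^ 2 + ‖b‖ₑ ^ 2) := by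
  have h : ‖a + b‖ ^ 2 ≤ 2 * (‖a‖ ^ 2 + ‖b‖ ^ 2) := by
    nlinarith [norm_add_le a b, norm_nonneg (a + b), sq_nonneg (‖a‖ - ‖b‖), norm_nonneg a,
      norm_nonneg b]
  have := ENNReal.ofReal_le_ofReal h
  rw [ENNReal.ofReal_mul (by norm_num), ENNReal.ofReal_add (by positivity) (by positivity)] at this
  simpa [ENNReal.ofReal_pow, ofReal_norm] using this

/-- Absolute continuity enters because `deriv` is additive only where both functions are
differentiable, which it guarantees almost everywhere. -/
lemma sobolevSq_add_le {L : ℝ} (hL : 0 ≤ L) {f g : ℝ → ℂ}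
    (hf : AbsolutelyContinuousOnInterval f 0 L) (hg : AbsolutelyContinuousOnInterval g 0 L) :
    sobolevSq L (f + g) ≤ 2 * (sobolevSq L f + sobolevSq L g) := by
  have hfm : AEMeasurable (fun t => ‖f t‖ₑ ^ 2) (volume.restrict (Ioo 0 L)) := by
    have := hf.continuousOn
    rw [uIcc_of_le hL] at this
    exact ((this.mono Ioo_subset_Icc_self).aestronglyMeasurable
      measurableSet_Ioo).enorm.pow_const 2
  have hfm' : AEMeasurable (fun t => ‖f t‖ₑ ^ 2 + ‖deriv f t‖ₑ ^ 2)
      (volume.restrict (Ioo 0 L)) :=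
    hfm.add ((measurable_deriv f).enorm.pow_const 2).aemeasurable
  rw [sobolevSq, sobolevSq, sobolevSq, ← lintegral_add_left' hfm',
    ← lintegral_const_mul' _ _ (by norm_num)]
  refine lintegral_mono_ae ?_
  filter_upwards [hf.ae_differentiableAt_restrict hL, hg.ae_differentiableAt_restrict hL]
    with t h1 h2
  rw [deriv_add h1 h2]
  calc _ ≤ 2 * (‖f t‖ₑ ^ 2 + ‖g t‖ₑ ^ 2) + 2 * (‖deriv f t‖ₑ ^ 2 + ‖deriv g t‖ₑ ^ 2) :=
        add_le_add (sq_enorm_add_le _ _) (sq_enorm_add_le _ _)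
    _ = _ := by ring

/-- The squared absolute value of an `H¹` function oscillates by at most its squared norm. -/
lemma edist_norm_sq_le_sobolevSq {L : ℝ} {f : ℝ → ℂ}
    (hf : AbsolutelyContinuousOnInterval f 0 L) {s t : ℝ} (hs : s ∈ Icc 0 L) (ht : t ∈ Icc 0 L) :
    edist (‖f s‖ ^ 2) (‖f t‖ ^ 2) ≤ sobolevSq L f := by
  wlog hst : s ≤ t generalizing s t
  · rw [edist_comm]; exact this ht hs (le_of_not_ge hst)
  have hL : 0 ≤ L := hs.1.trans hs.2
  have hre : AbsolutelyContinuousOnInterval (Complex.re ∘ f) 0 L :=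
    (LipschitzWith.of_le_add_mul 1 fun x y => by
      have := Complex.abs_re_le_norm (x - y)
      rw [Complex.sub_re] at this
      simp only [NNReal.coe_one, one_mul, dist_eq_norm]
      linarith [le_abs_self (x.re - y.re)]).comp_absolutelyContinuousOnInterval hf
  have him : AbsolutelyContinuousOnInterval (Complex.im ∘ f) 0 L :=
    (LipschitzWith.of_le_add_mul 1 fun x y => by
      have := Complex.abs_im_le_norm (x - y)
      rw [Complex.sub_im] at this
      simp only [NNReal.coe_one, one_mul, dist_eq_norm]
      linarith [le_abs_self (x.im - y.im)]).comp_absolutelyContinuousOnInterval hf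
  -- Writing |f|² as re² + im² exhibits it as a real absolutely continuous function, to which the
  -- fundamental theorem of calculus applies.
  have hg : AbsolutelyContinuousOnInterval (fun t => ‖f t‖ ^ 2) s t := by
    refine (((hre.mul hre).add (him.mul him)).congr fun x _ => ?_).mono ?_
    · simp [← Complex.normSq_apply, Complex.normSq_eq_norm_sq]
    · rw [uIcc_of_le hst, uIcc_of_le hL]; exact Icc_subset_Icc hs.1 ht.2
  rw [edist_comm, edist_eq_enorm_sub, ← hg.integral_deriv_eq_sub]
  rw [intervalIntegral.integral_of_le hst]
  refine (enorm_integral_le_lintegral_enorm _).trans ?_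
  rw [restrict_Ioo_eq_restrict_Ioc.symm, sobolevSq]
  refine (lintegral_mono_set (Ioo_subset_Ioo hs.1 ht.2)).trans (lintegral_mono_ae ?_)
  filter_upwards [hf.ae_differentiableAt_restrict hL] with x hx
  have h1 : HasDerivAt (fun t => ‖f t‖ ^ 2) (2 * inner ℝ (f x) (deriv f x)) x := hx.hasDerivAt.norm_sq
  rw [h1.deriv]
  -- Cauchy–Schwarz and 2ab ≤ a² + b²; no constant depending on `L` appears, so the bound can be
  -- added over edges of any lengths.
  have h2 : ‖2 * inner ℝ (f x) (deriv f x)‖ ≤ ‖f x‖ ^ 2 + ‖deriv f x‖ ^ 2 := by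
    rw [norm_mul]
    have := norm_inner_le_norm (𝕜 := ℝ) (f x) (deriv f x)
    simp only [Real.norm_ofNat]
    nlinarith [sq_nonneg (‖f x‖ - ‖deriv f x‖)]
  have := ENNReal.ofReal_le_ofReal h2
  rw [ENNReal.ofReal_add (by positivity) (by positivity), ofReal_norm] at this
  simpa [ENNReal.ofReal_pow, ofReal_norm] using this

lemma IntervalH1.intervalIntegrable_deriv {L : ℝ} (hL : 0 ≤ L) {f : ℝ → ℂ}
    (hf : IntervalH1 L f) : IntervalIntegrable (deriv f) volume 0 L := by
  rw [intervalIntegrable_iff_integrableOn_Ioo_of_le hL]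
  exact hf.2.integrable (by norm_num)

lemma IntervalH1.integral_deriv_eq_sub {L : ℝ} {f : ℝ → ℂ} (hf : IntervalH1 L f) {t : ℝ}
    (ht : t ∈ Icc 0 L) : ∫ x in (0 : ℝ)..t, deriv f x = f t - f 0 := by
  have hL : 0 ≤ L := ht.1.trans ht.2
  have hi : IntervalIntegrable (deriv f) volume 0 t :=
    (hf.intervalIntegrable_deriv hL).mono_set
      (by rw [uIcc_of_le hL, uIcc_of_le ht.1]; exact Icc_subset_Icc_right ht.2)
  have hft : AbsolutelyContinuousOnInterval f 0 t := hf.1.mono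
      (by rw [uIcc_of_le hL, uIcc_of_le ht.1]; exact Icc_subset_Icc_right ht.2)
  have key : ∀ φ : ℂ →L[ℝ] ℝ, φ (∫ x in (0 : ℝ)..t, deriv f x) = φ (f t - f 0) := by
    intro φ
    rw [← φ.intervalIntegral_comp_comm hi, map_sub]
    have h1 : AbsolutelyContinuousOnInterval (φ ∘ f) 0 t :=
      φ.lipschitz.comp_absolutelyContinuousOnInterval hft
    rw [show φ (f t) = (φ ∘ f) t from rfl, show φ (f 0) = (φ ∘ f) 0 from rfl,
      ← h1.integral_deriv_eq_sub]
    refine intervalIntegral.integral_congr_ae ?_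
    filter_upwards [hft.boundedVariationOn.ae_differentiableAt_of_mem_uIcc] with x hx hxt
    exact ((φ.hasFDerivAt.comp_hasDerivAt x (hx (uIoc_subset_uIcc hxt)).hasDerivAt).deriv).symm
  exact Complex.ext (key Complex.reCLM) (key Complex.imCLM)

/-! ### Truncation -/

/-- A cut-off map on `ℂ`: the identity on the ball of radius `r`, zero outside the ball of radius
`2 * r`. -/
def truncate (r : ℝ) (z : ℂ) : ℂ := (min 1 (max 0 (2 - ‖z‖ / r)) : ℝ) • z

lemma truncate_of_norm_le {r : ℝ} (hr : 0 < r) {z : ℂ} (hz : ‖z‖ ≤ r) : truncate r z = z := by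
  have : ‖z‖ / r ≤ 1 := (div_le_one hr).2 hz
  rw [truncate, max_eq_right (by linarith), min_eq_left (by linarith), one_smul]

lemma truncate_of_le_norm {r : ℝ} (hr : 0 < r) {z : ℂ} (hz : 2 * r ≤ ‖z‖) : truncate r z = 0 := by
  have : 2 ≤ ‖z‖ / r := (le_div_iff₀ hr).2 hz
  rw [truncate, max_eq_left (by linarith), min_eq_right (by norm_num), zero_smul]

lemma norm_truncate_le (r : ℝ) (z : ℂ) : ‖truncate r z‖ ≤ ‖z‖ := by
  rw [truncate, norm_smul, Real.norm_of_nonneg (le_min zero_le_one (le_max_left _ _))]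
  exact mul_le_of_le_one_left (norm_nonneg _) (min_le_left _ _)

/-- The constant does not depend on `r`: the scalar factor is (1/r)-Lipschitz and multiplies the
shorter vector, of norm below 2r, which costs 2; the vector itself, with a factor at most 1, costs
1. -/
lemma lipschitzWith_truncate {r : ℝ} (hr : 0 < r) : LipschitzWith 3 (truncate r) := by
  refine LipschitzWith.of_dist_le_mul fun z w => ?_
  wlog h : ‖w‖ ≤ ‖z‖ generalizing z w
  · rw [dist_comm, dist_comm z]; exact this w z (le_of_not_ge h)
  by_cases hw : 2 * r ≤ ‖w‖
  · rw [truncate_of_le_norm hr hw, truncate_of_le_norm hr (hw.trans h), dist_self]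
    positivity
  rw [dist_eq_norm, dist_eq_norm, truncate, truncate]
  set m := min 1 (max 0 (2 - ‖z‖ / r)) with hm
  set k := min 1 (max 0 (2 - ‖w‖ / r)) with hk
  have hm1 : ‖m‖ ≤ 1 := by
    rw [Real.norm_of_nonneg (le_min zero_le_one (le_max_left _ _))]; exact min_le_left _ _
  have hmk : ‖m - k‖ ≤ ‖z - w‖ / r := by
    have h1 : |m - k| ≤ |max 0 (2 - ‖z‖ / r) - max 0 (2 - ‖w‖ / r)| := by
      have := abs_min_sub_min_le_max 1 (max 0 (2 - ‖z‖ / r)) 1 (max 0 (2 - ‖w‖ / r))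
      simpa using this
    have h2 : |max 0 (2 - ‖z‖ / r) - max 0 (2 - ‖w‖ / r)| ≤ |(2 - ‖z‖ / r) - (2 - ‖w‖ / r)| := by
      have := abs_max_sub_max_le_max 0 (2 - ‖z‖ / r) 0 (2 - ‖w‖ / r)
      simpa using this
    have h3 : |(2 - ‖z‖ / r) - (2 - ‖w‖ / r)| ≤ ‖z - w‖ / r := by
      rw [show (2 - ‖z‖ / r) - (2 - ‖w‖ / r) = (‖w‖ - ‖z‖) / r by ring, abs_div, abs_of_pos hr,
        abs_sub_comm]
      gcongr
      exact abs_norm_sub_norm_le _ _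
    exact (h1.trans h2).trans h3
  have e : m • z - k • w = m • (z - w) + (m - k) • w := by module
  calc ‖m • z - k • w‖ ≤ ‖m‖ * ‖z - w‖ + ‖m - k‖ * ‖w‖ := by
        rw [e]; refine (norm_add_le _ _).trans ?_; rw [norm_smul, norm_smul]
    _ ≤ 1 * ‖z - w‖ + ‖z - w‖ / r * (2 * r) := by
        gcongr
        exact (not_le.1 hw).le
    _ = _ := by push_cast; field_simp; norm_num

/-- The composite may fail to be differentiable where |f| crosses r or 2r. The difference-quotient
bound used here covers that case too, `deriv` being 0 there. -/
lemma norm_deriv_truncate_comp_le {r : ℝ} (hr : 0 < r) {f : ℝ → ℂ} {t : ℝ}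
    (hf : DifferentiableAt ℝ f t) : ‖deriv (truncate r ∘ f) t‖ ≤ 3 * ‖deriv f t‖ := by
  refine le_of_forall_pos_le_add fun ε hε => norm_deriv_le_of_lip' (by positivity) ?_
  have h := hf.hasDerivAt.isLittleO.def (c := ε / 3) (by positivity)
  filter_upwards [h] with x hx
  have h1 : ‖truncate r (f x) - truncate r (f t)‖ ≤ 3 * ‖f x - f t‖ := by
    simpa [dist_eq_norm] using (lipschitzWith_truncate hr).dist_le_mul (f x) (f t)
  have h2 : ‖f x - f t‖ ≤ ε / 3 * ‖x - t‖ + ‖x - t‖ * ‖deriv f t‖ := by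
    have := norm_add_le (f x - f t - (x - t) • deriv f t) ((x - t) • deriv f t)
    rw [sub_add_cancel, norm_smul] at this
    linarith
  simp only [Function.comp]
  nlinarith

lemma enorm_deriv_truncate_comp_sq_le {r : ℝ} (hr : 0 < r) {f : ℝ → ℂ} {t : ℝ}
    (hf : DifferentiableAt ℝ f t) :
    ‖deriv (truncate r ∘ f) t‖ₑ ^ 2 ≤ 9 * ‖deriv f t‖ₑ ^ 2 := by
  have := ENNReal.ofReal_le_ofReal (norm_deriv_truncate_comp_le hr hf)
  rw [ENNReal.ofReal_mul (by norm_num), ofReal_norm, ofReal_norm] at this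
  calc _ ≤ (ENNReal.ofReal 3 * ‖deriv f t‖ₑ) ^ 2 := by gcongr
    _ = _ := by rw [mul_pow]; norm_num

lemma IntervalH1.truncate_comp {L r : ℝ} (hL : 0 ≤ L) (hr : 0 < r) {f : ℝ → ℂ}
    (hf : IntervalH1 L f) : IntervalH1 L (truncate r ∘ f) := by
  refine ⟨(lipschitzWith_truncate hr).comp_absolutelyContinuousOnInterval hf.1, ?_⟩
  refine MemLp.of_le_mul hf.2 (measurable_deriv _).aestronglyMeasurable (c := 3) ?_
  filter_upwards [hf.1.ae_differentiableAt_restrict hL] with t ht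
  exact norm_deriv_truncate_comp_le hr ht

lemma sq_add_sq_truncate_le {r : ℝ} (hr : 0 < r) {f : ℝ → ℂ} {t : ℝ}
    (hf : DifferentiableAt ℝ f t) :
    ‖(truncate r ∘ f) t‖ₑ ^ 2 + ‖deriv (truncate r ∘ f) t‖ₑ ^ 2 ≤
      9 * (‖f t‖ₑ ^ 2 + ‖deriv f t‖ₑ ^ 2) := by
  rw [mul_add]
  refine add_le_add ?_ (enorm_deriv_truncate_comp_sq_le hr hf)
  calc ‖(truncate r ∘ f) t‖ₑ ^ 2 ≤ 1 * ‖f t‖ₑ ^ 2 := by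
        rw [one_mul]
        gcongr
        exact enorm_le_iff_norm_le.2 (norm_truncate_le _ _)
    _ ≤ _ := by gcongr; norm_num

lemma sobolevSq_truncate_comp_le {L r : ℝ} (hL : 0 ≤ L) (hr : 0 < r) {f : ℝ → ℂ}
    (hf : IntervalH1 L f) : sobolevSq L (truncate r ∘ f) ≤ 9 * sobolevSq L f := by
  rw [sobolevSq, sobolevSq, ← lintegral_const_mul' _ _ (by norm_num)]
  refine lintegral_mono_ae ?_
  filter_upwards [hf.1.ae_differentiableAt_restrict hL] with t ht
  exact sq_add_sq_truncate_le hr ht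

/-- The zeros of a function at which its derivative does not vanish are isolated zeros. -/
lemma countable_zero_and_deriv_ne_zero (f : ℝ → ℂ) : {t | f t = 0 ∧ deriv f t ≠ 0}.Countable := by
  refine (countable_setOfPred_isolated_right_within (s := {t | f t = 0})).mono ?_
  rintro t ⟨h0, h1⟩
  refine ⟨h0, ?_⟩
  have hd := (differentiableAt_of_deriv_ne_zero h1).hasDerivAt
  have hev := hd.eventually_ne (c := 0) h1
  rw [← empty_mem_iff_bot]
  have h2 : {t | f t = 0}ᶜ ∈ 𝓝[{t | f t = 0} ∩ Ioi t] t :=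
    nhdsWithin_mono t (fun x hx => (ne_of_gt hx.2 : x ≠ t)) hev
  filter_upwards [h2, self_mem_nhdsWithin] with x hx h'x
  exact hx h'x.1

/-- Needed on the zero set of `f`, the only place where shrinking the truncation radius does not
make the truncated function vanish locally. -/
lemma ae_deriv_eq_zero_of_eq_zero (f : ℝ → ℂ) : ∀ᵐ t, f t = 0 → deriv f t = 0 := by
  filter_upwards [(countable_zero_and_deriv_ne_zero f).ae_notMem volume] with t ht h0
  by_contra h
  exact ht ⟨h0, h⟩

/-- Dominated convergence. Where f ≠ 0 the integrand is eventually 0, as soon as 2r < |f|; where f =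
0, also f' = 0 almost everywhere, and the integrand vanishes for every radius. -/
lemma tendsto_sobolevSq_truncate_comp {L : ℝ} (hL : 0 ≤ L) {f : ℝ → ℂ} (hf : IntervalH1 L f) :
    Tendsto (fun n : ℕ => sobolevSq L (truncate (1 / ((n : ℝ) + 1)) ∘ f)) atTop (𝓝 0) := by
  have hpos : ∀ n : ℕ, 0 < 1 / ((n : ℝ) + 1) := fun n => by positivity
  have hcont : ∀ n : ℕ, ContinuousOn (truncate (1 / ((n : ℝ) + 1)) ∘ f) (Ioo 0 L) := fun n => by
    have := (hf.truncate_comp hL (hpos n)).1.continuousOn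
    rw [uIcc_of_le hL] at this
    exact this.mono Ioo_subset_Icc_self
  have := tendsto_lintegral_of_dominated_convergence' (μ := volume.restrict (Ioo 0 L))
    (F := fun (n : ℕ) t => ‖(truncate (1 / ((n : ℝ) + 1)) ∘ f) t‖ₑ ^ 2 +
      ‖deriv (truncate (1 / ((n : ℝ) + 1)) ∘ f) t‖ₑ ^ 2) (f := 0)
    (fun t => 9 * (‖f t‖ₑ ^ 2 + ‖deriv f t‖ₑ ^ 2))
    (fun n => (((hcont n).aestronglyMeasurable measurableSet_Ioo).enorm.pow_const 2).add
      ((measurable_deriv _).enorm.pow_const 2).aemeasurable) (fun n => ?_) ?_ ?_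
  · simpa [sobolevSq] using this
  · filter_upwards [hf.1.ae_differentiableAt_restrict hL] with t ht
    exact sq_add_sq_truncate_le (hpos n) ht
  · rw [lintegral_const_mul' _ _ (by norm_num)]
    exact ENNReal.mul_ne_top (by norm_num) (hf.sobolevSq_lt_top hL).ne
  · filter_upwards [hf.1.ae_differentiableAt_restrict hL,
      ae_restrict_of_ae (ae_deriv_eq_zero_of_eq_zero f)] with t ht h0
    by_cases hft : f t = 0
    · have h1 : ∀ n : ℕ, ‖(truncate (1 / ((n : ℝ) + 1)) ∘ f) t‖ₑ ^ 2 +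
          ‖deriv (truncate (1 / ((n : ℝ) + 1)) ∘ f) t‖ₑ ^ 2 = 0 := fun n => by
        have := sq_add_sq_truncate_le (hpos n) ht
        simpa [hft, h0 hft] using this
      simp only [h1]
      exact tendsto_const_nhds
    · refine tendsto_const_nhds.congr' ?_
      have h2 : Tendsto (fun n : ℕ => 2 * (1 / ((n : ℝ) + 1))) atTop (𝓝 0) := by
        simpa using tendsto_one_div_add_atTop_nhds_zero_nat.const_mul (2 : ℝ)
      filter_upwards [h2.eventually_lt_const (norm_pos_iff.2 hft)] with n hn
      have h3 : truncate (1 / ((n : ℝ) + 1)) ∘ f =ᶠ[𝓝 t] fun _ => 0 := by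
        filter_upwards [ht.continuousAt.norm.eventually_const_lt hn] with x hx
        exact truncate_of_le_norm (hpos n) hx.le
      rw [h3.deriv_eq, h3.eq_of_nhds]
      simp

/-! ### Smoothing -/

/-- Cauchy–Schwarz against the constant 1. -/
lemma sq_setLIntegral_Ioo_le (L : ℝ) {u : ℝ → ℝ≥0∞}
    (hu : AEMeasurable u (volume.restrict (Ioo 0 L))) :
    (∫⁻ t in Ioo 0 L, u t) ^ 2 ≤ ENNReal.ofReal L * ∫⁻ t in Ioo 0 L, u t ^ 2 := by
  have h := ENNReal.lintegral_mul_le_Lp_mul_Lq (volume.restrict (Ioo 0 L))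
    Real.HolderConjugate.two_two (f := fun _ => 1) aemeasurable_const hu
  simp only [Pi.mul_apply, one_mul, ENNReal.one_rpow, lintegral_const, Measure.restrict_apply,
    MeasurableSet.univ, univ_inter, Real.volume_Ioo, sub_zero] at h
  calc _ ≤ (ENNReal.ofReal L ^ (1 / 2 : ℝ) *
        (∫⁻ t in Ioo 0 L, u t ^ (2 : ℝ)) ^ (1 / 2 : ℝ)) ^ 2 := by gcongr
    _ = _ := by
      rw [mul_pow, ← ENNReal.rpow_natCast, ← ENNReal.rpow_natCast, ← ENNReal.rpow_mul,
        ← ENNReal.rpow_mul]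
      simp

/-- Smooth functions approximate a square integrable function on an interval while having small
values at the endpoints. -/
lemma exists_contDiff_approx_with_endpoints {L : ℝ} {u : ℝ → ℂ}
    (hu : MemLp u 2 (volume.restrict (Ioo 0 L))) {η : ℝ} (hη : 0 < η) :
    ∃ q : ℝ → ℂ, ContDiff ℝ 1 q ∧ (∫⁻ t in Ioo 0 L, ‖u t - q t‖ₑ ^ 2) ≤ ENNReal.ofReal η ^ 2 ∧
      ‖q 0‖ₑ ^ 2 ≤ ENNReal.ofReal η ^ 2 ∧ ‖q L‖ₑ ^ 2 ≤ ENNReal.ofReal η ^ 2 := by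
  -- Unit masses at the two endpoints turn the endpoint values into part of the L² norm. Density of
  -- smooth functions in L²(μ), applied to `u` extended by 0, then controls them together with the
  -- integral.
  set μ : Measure ℝ := volume.restrict (Ioo 0 L) + (Measure.dirac 0 + Measure.dirac L) with hμ
  have hsq : ∀ v : ℝ → ℂ, ∫⁻ t, ‖v t‖ₑ ^ 2 ∂μ =
      (∫⁻ t in Ioo 0 L, ‖v t‖ₑ ^ 2) + (‖v 0‖ₑ ^ 2 + ‖v L‖ₑ ^ 2) := fun v => by
    rw [hμ, lintegral_add_measure, lintegral_add_measure, lintegral_dirac, lintegral_dirac]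
  set U : ℝ → ℂ := (Ioo 0 L).indicator u with hU
  have hUu : ∀ t ∈ Ioo 0 L, U t = u t := fun t ht => indicator_of_mem ht u
  have hU0 : U 0 = 0 := indicator_of_notMem (by simp) u
  have hUL : U L = 0 := indicator_of_notMem (by simp) u
  have hUmem : MemLp U 2 μ := by
    constructor
    · refine aestronglyMeasurable_add_measure_iff.2
        ⟨(aestronglyMeasurable_indicator_iff measurableSet_Ioo).2 ?_,
          aestronglyMeasurable_add_measure_iff.2
            ⟨aestronglyMeasurable_dirac, aestronglyMeasurable_dirac⟩⟩
      rw [Measure.restrict_restrict measurableSet_Ioo, inter_self]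
      exact hu.1
    · rw [eLpNorm_lt_top_iff_lintegral_rpow_enorm_lt_top (by norm_num) (by norm_num)]
      have := (eLpNorm_lt_top_iff_lintegral_rpow_enorm_lt_top (by norm_num) (by norm_num)).1 hu.2
      simp only [ENNReal.toReal_ofNat, ENNReal.rpow_ofNat] at this ⊢
      rw [hsq, hU0, hUL, setLIntegral_congr_fun (g := fun t => ‖u t‖ₑ ^ 2) measurableSet_Ioo
        (fun t ht => by simp only [hUu t ht])]
      simpa using this
  obtain ⟨q, -, hq, hle⟩ := hUmem.exist_eLpNorm_sub_le (by norm_num) (by norm_num) hη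
  have hle2 : ∫⁻ t, ‖(U - q) t‖ₑ ^ 2 ∂μ ≤ ENNReal.ofReal η ^ 2 := by
    have h := eLpNorm_nnreal_pow_eq_lintegral (f := U - q) (μ := μ) (p := 2) (by norm_num)
    simp only [ENNReal.coe_ofNat, NNReal.coe_ofNat, ENNReal.rpow_ofNat] at h
    rw [← h]
    gcongr
  rw [hsq] at hle2
  refine ⟨q, hq.of_le (by exact_mod_cast le_top), ?_, ?_, ?_⟩
  · refine le_trans (le_of_eq ?_) (le_self_add.trans hle2)
    exact setLIntegral_congr_fun measurableSet_Ioo fun t ht => by simp [hUu t ht]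
  · simpa [hU0] using (le_self_add.trans le_add_self).trans hle2
  · simpa [hUL] using (le_add_self.trans le_add_self).trans hle2

lemma sq_enorm_add_add_le (a b c : ℂ) :
    ‖a + b + c‖ₑ ^ 2 ≤ 3 * (‖a‖ₑ ^ 2 + ‖b‖ₑ ^ 2 + ‖c‖ₑ ^ 2) := by
  have h : ‖a + b + c‖ ^ 2 ≤ 3 * (‖a‖ ^ 2 + ‖b‖ ^ 2 + ‖c‖ ^ 2) := by
    have h1 : ‖a + b + c‖ ≤ ‖a‖ + ‖b‖ + ‖c‖ := norm_add₃_le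
    have h2 := pow_le_pow_left₀ (norm_nonneg _) h1 2
    nlinarith [sq_nonneg (‖a‖ - ‖b‖), sq_nonneg (‖a‖ - ‖c‖), sq_nonneg (‖b‖ - ‖c‖)]
  have := ENNReal.ofReal_le_ofReal h
  rw [ENNReal.ofReal_mul (by norm_num), ENNReal.ofReal_add (by positivity) (by positivity),
    ENNReal.ofReal_add (by positivity) (by positivity)] at this
  simpa [ENNReal.ofReal_pow, ofReal_norm] using this

/-- A bump vanishing at both endpoints, used to correct an integral without disturbing endpoint
values. -/
lemma integral_bump {L : ℝ} (hL : 0 < L) : ∫ t in (0 : ℝ)..L, 6 * t * (L - t) / L ^ 3 = 1 := by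
  have h : ∀ t ∈ uIcc 0 L, HasDerivAt (fun t : ℝ => (3 * L * t ^ 2 - 2 * t ^ 3) / L ^ 3)
      (6 * t * (L - t) / L ^ 3) t := fun t _ => by
    have h1 := (((hasDerivAt_pow 2 t).const_mul (3 * L)).sub
      ((hasDerivAt_pow 3 t).const_mul 2)).div_const (L ^ 3)
    convert! h1 using 1
    push_cast
    ring
  rw [intervalIntegral.integral_eq_sub_of_hasDerivAt h
    (Continuous.intervalIntegrable (by fun_prop) _ _)]
  field_simp
  ring

/-- Smooth functions with prescribed integral that vanish at the endpoints are dense in `L²`. -/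
lemma exists_contDiff_approx_integral_eq {L : ℝ} (hL : 0 < L) {u : ℝ → ℂ}
    (hu : MemLp u 2 (volume.restrict (Ioo 0 L))) {δ : ℝ≥0∞} (hδ : 0 < δ) :
    ∃ q : ℝ → ℂ, ContDiff ℝ 1 q ∧ q 0 = 0 ∧ q L = 0 ∧
      ∫ t in (0 : ℝ)..L, q t = ∫ t in (0 : ℝ)..L, u t ∧
      ∫⁻ t in Ioo 0 L, ‖u t - q t‖ₑ ^ 2 ≤ δ := by
  -- The inner factor 3(η² + 2η²L) bounds the error after removing the endpoint values of a first
  -- approximation. Correcting the integral multiplies it by 74 = 2(1 + 6²), because the bump is at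
  -- most 6/L.
  obtain ⟨η, hη, hηδ⟩ : ∃ η : ℝ, 0 < η ∧
      74 * (3 * (ENNReal.ofReal η ^ 2 + 2 * (ENNReal.ofReal η ^ 2 * ENNReal.ofReal L))) ≤ δ := by
    have h : Tendsto (fun η : ℝ => 74 * (3 * (ENNReal.ofReal η ^ 2 +
        2 * (ENNReal.ofReal η ^ 2 * ENNReal.ofReal L)))) (𝓝[>] 0) (𝓝 0) := by
      have h1 : Tendsto (fun η : ℝ => ENNReal.ofReal η ^ 2) (𝓝[>] 0) (𝓝 0) := by
        have : Continuous fun η : ℝ => ENNReal.ofReal η ^ 2 :=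
        (ENNReal.continuous_pow 2).comp ENNReal.continuous_ofReal
        simpa using (this.tendsto 0).mono_left nhdsWithin_le_nhds
      have h2 := ENNReal.Tendsto.const_mul (a := 2)
        (ENNReal.Tendsto.mul_const h1 (b := ENNReal.ofReal L) (Or.inr (by simp)))
        (Or.inr (by simp))
      have h3 := ENNReal.Tendsto.const_mul (a := 74) (ENNReal.Tendsto.const_mul (a := 3)
        (h1.add h2) (Or.inr (by simp))) (Or.inr (by simp))
      simpa using h3
    obtain ⟨η, h1, h2⟩ := ((h.eventually_le_const hδ).and self_mem_nhdsWithin).exists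
    exact ⟨η, h2, h1⟩
  obtain ⟨p, hp, hp1, hp2, hp3⟩ := exists_contDiff_approx_with_endpoints hu hη
  have hui : IntervalIntegrable u volume 0 L := by
    rw [intervalIntegrable_iff_integrableOn_Ioo_of_le hL.le]
    exact hu.integrable (by norm_num)
  -- Subtracting the affine interpolation of the endpoint values makes both of them zero.
  set r : ℝ → ℂ := fun t => p t - (((1 - t / L : ℝ)) • p 0 + (t / L : ℝ) • p L) with hr
  have hrc : ContDiff ℝ 1 r := by
    refine hp.sub (((contDiff_const.sub (contDiff_id.div_const L)).smul contDiff_const).add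
      ((contDiff_id.div_const L).smul contDiff_const))
  set J := ∫⁻ t in Ioo 0 L, ‖u t - r t‖ₑ ^ 2 with hJ
  have hum : AEMeasurable (fun t => ‖u t - p t‖ₑ ^ 2) (volume.restrict (Ioo 0 L)) :=
    (hu.1.sub hp.continuous.aestronglyMeasurable).enorm.pow_const 2
  have hJle : J ≤ 3 * (ENNReal.ofReal η ^ 2 + 2 * (ENNReal.ofReal η ^ 2 * ENNReal.ofReal L)) := by
    calc J ≤ ∫⁻ t in Ioo 0 L, 3 * (‖u t - p t‖ₑ ^ 2 + 2 * ENNReal.ofReal η ^ 2) := by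
          refine setLIntegral_mono_ae' measurableSet_Ioo (.of_forall fun t ht => ?_)
          have e : u t - r t = (u t - p t) + (1 - t / L : ℝ) • p 0 + (t / L : ℝ) • p L := by
            simp only [hr]; ring
          have h0 : 0 ≤ t / L := div_nonneg ht.1.le hL.le
          have h1 : t / L ≤ 1 := (div_le_one hL).2 ht.2.le
          have hs : ∀ (c : ℝ) (z : ℂ), 0 ≤ c → c ≤ 1 → ‖z‖ₑ ^ 2 ≤ ENNReal.ofReal η ^ 2 →
              ‖c • z‖ₑ ^ 2 ≤ ENNReal.ofReal η ^ 2 := fun c z hc hc' hz => by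
            refine le_trans ?_ hz
            gcongr
            rw [enorm_le_iff_norm_le, norm_smul, Real.norm_of_nonneg hc]
            exact mul_le_of_le_one_left (norm_nonneg _) hc'
          rw [e]
          refine (sq_enorm_add_add_le _ _ _).trans ?_
          rw [two_mul, ← add_assoc]
          exact mul_le_mul_right (add_le_add (add_le_add le_rfl
            (hs _ _ (by linarith) (by linarith) hp2)) (hs _ _ h0 h1 hp3)) 3
      _ = 3 * ((∫⁻ t in Ioo 0 L, ‖u t - p t‖ₑ ^ 2) +
            2 * ENNReal.ofReal η ^ 2 * ENNReal.ofReal L) := by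
          rw [lintegral_const_mul' _ _ (by norm_num), lintegral_add_left' hum]
          simp
      _ ≤ _ := by
          rw [← mul_assoc 2]
          gcongr
  -- The defect of the integral, restored below as a multiple of the bump.
  set d : ℂ := ∫ t in (0 : ℝ)..L, (u t - r t) with hd
  have hdJ : ‖d‖ₑ ^ 2 ≤ ENNReal.ofReal L * J := by
    refine le_trans ?_ (sq_setLIntegral_Ioo_le L (u := fun t => ‖u t - r t‖ₑ)
      (hu.1.sub hrc.continuous.aestronglyMeasurable).enorm)
    gcongr
    rw [hd, intervalIntegral.integral_of_le hL.le, ← restrict_Ioo_eq_restrict_Ioc]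
    exact enorm_integral_le_lintegral_enorm _
  set b : ℝ → ℝ := fun t => 6 * t * (L - t) / L ^ 3 with hb
  have hbc : ContDiff ℝ 1 b := by fun_prop
  refine ⟨fun t => r t + b t • d, hrc.add (hbc.smul contDiff_const), ?_, ?_, ?_, ?_⟩
  · simp [hr, hb]
  · simp [hr, hb, hL.ne']
  · have hbi : IntervalIntegrable (fun t => b t • d) volume 0 L :=
      (hbc.continuous.smul continuous_const).intervalIntegrable _ _
    beta_reduce
    rw [intervalIntegral.integral_add (hrc.continuous.intervalIntegrable _ _) hbi,
      intervalIntegral.integral_smul_const, integral_bump hL, one_smul, hd,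
      intervalIntegral.integral_sub hui (hrc.continuous.intervalIntegrable _ _)]
    ring
  · refine le_trans ?_ hηδ
    refine le_trans ?_ (mul_le_mul_right hJle 74)
    have hrm : AEMeasurable (fun t => ‖u t - r t‖ₑ ^ 2) (volume.restrict (Ioo 0 L)) :=
      (hu.1.sub hrc.continuous.aestronglyMeasurable).enorm.pow_const 2
    calc _ ≤ ∫⁻ t in Ioo 0 L, 2 * (‖u t - r t‖ₑ ^ 2 +
            ENNReal.ofReal (6 / L) ^ 2 * (ENNReal.ofReal L * J)) := by
          refine setLIntegral_mono_ae' measurableSet_Ioo (.of_forall fun t ht => ?_)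
          have e : u t - (r t + b t • d) = (u t - r t) + (-b t) • d := by
            rw [neg_smul]; ring
          rw [e]
          refine (sq_enorm_add_le _ _).trans ?_
          rw [enorm_smul, mul_pow]
          gcongr
          rw [← ofReal_norm, norm_neg]
          refine ENNReal.ofReal_le_ofReal ?_
          have ht0 := ht.1
          have ht1 := ht.2
          rw [Real.norm_of_nonneg (by
            simp only [hb]
            have : 0 < L - t := by linarith
            positivity), hb, div_le_div_iff₀ (by positivity) hL]
          have h1 : t * (L - t) ≤ L * L := by nlinarith
          nlinarith [mul_le_mul_of_nonneg_right h1 hL.le]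
      _ = 2 * (J + ENNReal.ofReal (6 / L) ^ 2 * (ENNReal.ofReal L * J) * ENNReal.ofReal L) := by
          rw [lintegral_const_mul' _ _ (by norm_num), lintegral_add_left' hrm]
          simp [hJ]
      _ = 74 * J := by
          have : ENNReal.ofReal (6 / L) ^ 2 * (ENNReal.ofReal L * J) * ENNReal.ofReal L
              = (ENNReal.ofReal (6 / L) * ENNReal.ofReal L) ^ 2 * J := by ring
          rw [this, ← ENNReal.ofReal_mul (by positivity), div_mul_cancel₀ _ hL.ne']
          norm_num
          ring

/-- Every `H¹` function is approximated by twice continuously differentiable functions with the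
same boundary values and vanishing derivative at the endpoints. -/
lemma IntervalH1.exists_smooth_approx {L : ℝ} (hL : 0 < L) {f : ℝ → ℂ} (hf : IntervalH1 L f)
    {δ : ℝ≥0∞} (hδ : 0 < δ) :
    ∃ g : ℝ → ℂ, ContDiff ℝ 2 g ∧ g 0 = f 0 ∧ g L = f L ∧ deriv g 0 = 0 ∧ deriv g L = 0 ∧
      sobolevSq L (f - g) ≤ δ := by
  -- With I the squared L² error of the derivative, the pointwise bound |f - g|² ≤ L·I integrates to
  -- L²·I, and the derivative itself contributes I.
  set c : ℝ≥0∞ := ENNReal.ofReal L ^ 2 + 1 with hc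
  have hc0 : c ≠ 0 := by simp [hc]
  have hct : c ≠ ∞ := by simp [hc]
  obtain ⟨q, hq, hq0, hqL, hqi, hqle⟩ := exists_contDiff_approx_integral_eq hL hf.2
    (δ := δ / c) (ENNReal.div_pos hδ.ne' hct)
  -- A primitive of `q`: the integral of `q` fixes the value at `L`, and its zeros at the endpoints
  -- make the derivative of `g` vanish there.
  set g : ℝ → ℂ := fun t => f 0 + ∫ x in (0 : ℝ)..t, q x with hg
  have hgd : ∀ t, HasDerivAt g (q t) t := fun t =>
    (intervalIntegral.integral_hasDerivAt_right (hq.continuous.intervalIntegrable _ _)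
      (hq.continuous.stronglyMeasurableAtFilter _ _) hq.continuous.continuousAt).const_add _
  have hgd' : deriv g = q := funext fun t => (hgd t).deriv
  have hg2 : ContDiff ℝ 2 g := by
    have : ContDiff ℝ (1 + 1) g := contDiff_succ_iff_deriv.2
      ⟨fun t => (hgd t).differentiableAt, by simp, by rwa [hgd']⟩
    simpa [one_add_one_eq_two] using this
  refine ⟨g, hg2, by simp [hg], ?_, by rw [hgd', hq0], by rw [hgd', hqL], ?_⟩
  · simp only [hg]
    rw [hqi, hf.integral_deriv_eq_sub (right_mem_Icc.2 hL.le)]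
    ring
  set I := ∫⁻ t in Ioo 0 L, ‖deriv f t - q t‖ₑ ^ 2 with hI
  have hdiff : AEMeasurable (fun t => ‖deriv f t - q t‖ₑ) (volume.restrict (Ioo 0 L)) :=
    (hf.2.1.sub hq.continuous.aestronglyMeasurable).enorm
  have hpt : ∀ t ∈ Ioo 0 L, ‖(f - g) t‖ₑ ^ 2 ≤ ENNReal.ofReal L * I := fun t ht => by
    refine le_trans ?_ (sq_setLIntegral_Ioo_le L hdiff)
    gcongr
    have hsub : uIcc 0 t ⊆ uIcc 0 L := by
      rw [uIcc_of_le hL.le, uIcc_of_le ht.1.le]; exact Icc_subset_Icc_right ht.2.le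
    have e : (f - g) t = ∫ x in (0 : ℝ)..t, (deriv f x - q x) := by
      rw [intervalIntegral.integral_sub ((hf.intervalIntegrable_deriv hL.le).mono_set hsub)
        (hq.continuous.intervalIntegrable _ _),
        hf.integral_deriv_eq_sub (Ioo_subset_Icc_self ht)]
      simp only [hg, Pi.sub_apply]
      ring
    rw [e, intervalIntegral.integral_of_le ht.1.le, ← restrict_Ioo_eq_restrict_Ioc]
    exact (enorm_integral_le_lintegral_enorm _).trans
      (lintegral_mono_set (Ioo_subset_Ioo_right ht.2.le))
  calc sobolevSq L (f - g)
      = (∫⁻ t in Ioo 0 L, ‖(f - g) t‖ₑ ^ 2) + ∫⁻ t in Ioo 0 L, ‖deriv (f - g) t‖ₑ ^ 2 :=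
        sobolevSq_eq_add _ _
    _ ≤ (∫⁻ _ in Ioo 0 L, ENNReal.ofReal L * I) + I := by
        refine add_le_add (setLIntegral_mono_ae' measurableSet_Ioo (.of_forall hpt))
          (lintegral_mono_ae ?_)
        filter_upwards [hf.1.ae_differentiableAt_restrict hL.le] with t ht
        rw [deriv_sub ht (hgd t).differentiableAt, hgd']
    _ = c * I := by
        simp only [lintegral_const, Measure.restrict_apply, MeasurableSet.univ, univ_inter,
          Real.volume_Ioo, sub_zero, hc]
        ring
    _ ≤ c * (δ / c) := by gcongr
    _ = δ := ENNReal.mul_div_cancel hc0 hct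

variable {V : Type*} {Γ : MetricGraph V}

/-! ### Parametrization and topology -/

@[simp] lemma param_zero (e : Γ.Edge) : Γ.param e 0 = .vertex (Γ.src e) := by simp [param]

@[simp] lemma param_length (e : Γ.Edge) : Γ.param e (Γ.length e) = .vertex (Γ.tgt e) := by
  simp [param, Γ.length_pos e]

lemma param_of_mem_Ioo (e : Γ.Edge) {t : ℝ} (ht : t ∈ Ioo 0 (Γ.length e)) :
    Γ.param e t = .inner e t ht := by
  rw [param, dif_neg ht.1.not_ge, dif_neg ht.2.not_ge]

lemma zero_mem_Icc (e : Γ.Edge) : (0 : ℝ) ∈ Icc 0 (Γ.length e) := left_mem_Icc.2 (Γ.length_pos e).le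

lemma length_mem_Icc (e : Γ.Edge) : Γ.length e ∈ Icc 0 (Γ.length e) :=
  right_mem_Icc.2 (Γ.length_pos e).le

lemma Icc_cases {L t : ℝ} (ht : t ∈ Icc 0 L) : t = 0 ∨ t = L ∨ t ∈ Ioo 0 L := by
  rcases ht.1.eq_or_lt with h | h
  · exact .inl h.symm
  · rcases ht.2.eq_or_lt with h' | h'
    · exact .inr (.inl h')
    · exact .inr (.inr ⟨h, h'⟩)

lemma mem_edge_iff {e : Γ.Edge} {v : V} : v ∈ (e : Sym2 V) ↔ v = Γ.src e ∨ v = Γ.tgt e := by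
  rw [← Γ.mk_src_tgt e, Sym2.mem_iff]

lemma src_mem (e : Γ.Edge) : Γ.src e ∈ (e : Sym2 V) := mem_edge_iff.2 (.inl rfl)

lemma tgt_mem (e : Γ.Edge) : Γ.tgt e ∈ (e : Sym2 V) := mem_edge_iff.2 (.inr rfl)

lemma mem_edge_of_param_eq_vertex {e : Γ.Edge} {t : ℝ} (ht : t ∈ Icc 0 (Γ.length e)) {v : V}
    (h : Γ.param e t = .vertex v) : v ∈ (e : Sym2 V) := by
  rcases Icc_cases ht with rfl | rfl | h'
  · rw [param_zero, Point.vertex.injEq] at h; exact h ▸ src_mem e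
  · rw [param_length, Point.vertex.injEq] at h; exact h ▸ tgt_mem e
  · rw [param_of_mem_Ioo e h'] at h; cases h

lemma exists_param_eq_vertex {e : Γ.Edge} {v : V} (h : v ∈ (e : Sym2 V)) :
    ∃ t ∈ Icc 0 (Γ.length e), Γ.param e t = .vertex v := by
  rcases mem_edge_iff.1 h with rfl | rfl
  · exact ⟨0, zero_mem_Icc e, param_zero e⟩
  · exact ⟨_, length_mem_Icc e, param_length e⟩

lemma isOpen_iff {U : Set Γ.Point} :
    IsOpen U ↔ ∀ e, IsOpen ((fun t : Icc (0 : ℝ) (Γ.length e) => Γ.param e t) ⁻¹' U) := by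
  change IsOpen[⨆ e : Γ.Edge, TopologicalSpace.coinduced
    (fun t : Icc (0 : ℝ) (Γ.length e) => Γ.param e t) inferInstance] U ↔ _
  simp only [isOpen_iSup_iff, isOpen_coinduced]

lemma continuousOn_param (e : Γ.Edge) : ContinuousOn (Γ.param e) (Icc 0 (Γ.length e)) := by
  rw [continuousOn_iff_continuous_domRestrict]
  exact ⟨fun U hU => isOpen_iff.1 hU e⟩

lemma continuous_iff {f : Γ.Point → ℂ} :
    Continuous f ↔ ∀ e, ContinuousOn (Γ.onEdge f e) (Icc 0 (Γ.length e)) := by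
  refine ⟨fun h e => h.comp_continuousOn (continuousOn_param e), fun h => ⟨fun U hU => ?_⟩⟩
  refine isOpen_iff.2 fun e => ?_
  exact (continuousOn_iff_continuous_domRestrict.1 (h e)).isOpen_preimage U hU

/-- On each edge the preimage is empty or omits at most the two endpoints, so it is open. -/
lemma isOpen_of_edges {U : Set Γ.Point}
    (h : ∀ e, (∀ t ∈ Ioo 0 (Γ.length e), Γ.param e t ∈ U) ∨
      ∀ t ∈ Icc 0 (Γ.length e), Γ.param e t ∉ U) : IsOpen U := by
  refine isOpen_iff.2 fun e => ?_
  rcases h e with h | h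
  · rw [← isClosed_compl_iff]
    refine Set.Finite.isClosed (Set.Finite.subset
      (toFinite {⟨0, zero_mem_Icc e⟩, ⟨_, length_mem_Icc e⟩}) fun t ht => ?_)
    rcases Icc_cases t.2 with h0 | h0 | h0
    · exact .inl (Subtype.ext h0)
    · exact .inr (Subtype.ext h0)
    · exact (ht (h t h0)).elim
  · convert! isOpen_empty
    exact eq_empty_of_forall_notMem fun t ht => h t t.2 ht

lemma isClosed_of_edges {A : Set Γ.Point}
    (h : ∀ e, (∀ t ∈ Icc 0 (Γ.length e), Γ.param e t ∈ A) ∨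
      ∀ t ∈ Ioo 0 (Γ.length e), Γ.param e t ∉ A) : IsClosed A := by
  refine ⟨isOpen_of_edges fun e => (h e).symm.imp_right fun h t ht h' => h' (h t ht)⟩

/-- The union of the closed edges in a set of edges. -/
def edgeHull (F : Set Γ.Edge) : Set Γ.Point := ⋃ e ∈ F, Γ.param e '' Icc 0 (Γ.length e)

lemma mem_edgeHull {F : Set Γ.Edge} {p : Γ.Point} :
    p ∈ edgeHull F ↔ ∃ e ∈ F, ∃ t ∈ Icc 0 (Γ.length e), Γ.param e t = p := by
  simp only [edgeHull, mem_iUnion, mem_image, exists_prop]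

lemma isClosed_edgeHull (F : Set Γ.Edge) : IsClosed (edgeHull F) := by
  refine isClosed_of_edges fun e => ?_
  by_cases he : e ∈ F
  · exact .inl fun t ht => mem_edgeHull.2 ⟨e, he, t, ht, rfl⟩
  · refine .inr fun t ht h => ?_
    obtain ⟨e', he', s, hs, h'⟩ := mem_edgeHull.1 h
    rw [param_of_mem_Ioo e ht] at h'
    rcases Icc_cases hs with rfl | rfl | h0
    · rw [param_zero] at h'; cases h'
    · rw [param_length] at h'; cases h'
    · rw [param_of_mem_Ioo e' h0] at h'
      cases h'
      exact he he'

lemma isCompact_edgeHull {F : Set Γ.Edge} (hF : F.Finite) : IsCompact (edgeHull F) :=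
  hF.isCompact_biUnion fun e _ => isCompact_Icc.image_of_continuousOn (continuousOn_param e)

/-- The open star of a set of vertices: these vertices and the interiors of the incident edges. -/
def star (C : Set V) : Set Γ.Point :=
  {p | match p with
    | .vertex v => v ∈ C
    | .inner e _ _ => Γ.src e ∈ C ∨ Γ.tgt e ∈ C}

@[simp] lemma vertex_mem_star {C : Set V} {v : V} : (.vertex v : Γ.Point) ∈ star C ↔ v ∈ C :=
  Iff.rfl

lemma touches_of_param_mem_star {C : Set V} {e : Γ.Edge} {t : ℝ} (ht : t ∈ Icc 0 (Γ.length e))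
    (h : Γ.param e t ∈ star C) : Γ.src e ∈ C ∨ Γ.tgt e ∈ C := by
  rcases Icc_cases ht with rfl | rfl | h0
  · rw [param_zero] at h; exact .inl h
  · rw [param_length] at h; exact .inr h
  · rwa [param_of_mem_Ioo e h0] at h

lemma isOpen_star (C : Set V) : IsOpen (star C : Set Γ.Point) := by
  refine isOpen_of_edges fun e => ?_
  by_cases h : Γ.src e ∈ C ∨ Γ.tgt e ∈ C
  · exact .inl fun t ht => by rwa [param_of_mem_Ioo e ht]
  · exact .inr fun t ht h' => h (touches_of_param_mem_star ht h')

lemma finite_touching {C : Set V} (hC : C.Finite) :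
    {e : Γ.Edge | Γ.src e ∈ C ∨ Γ.tgt e ∈ C}.Finite := by
  refine (hC.biUnion fun v _ => Γ.locallyFinite v).subset fun e he => ?_
  simp only [mem_iUnion, exists_prop]
  rcases he with h | h
  · exact ⟨_, h, src_mem e⟩
  · exact ⟨_, h, tgt_mem e⟩

/-- A compact set meets only finitely many edges. -/
lemma exists_finite_edges_of_isCompact {K : Set Γ.Point} (hK : IsCompact K) :
    ∃ F : Set Γ.Edge, F.Finite ∧ ∀ e ∉ F, ∀ t ∈ Icc 0 (Γ.length e), Γ.param e t ∉ K := by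
  -- The stars of single vertices form an open cover, and local finiteness lets each of them meet
  -- only finitely many edges.
  obtain ⟨T, hT⟩ := hK.elim_finite_subcover (fun v : V => (star {v} : Set Γ.Point))
    (fun v => isOpen_star _) (fun p _ => by
      rcases p with v | ⟨e, t, ht⟩
      · exact mem_iUnion.2 ⟨v, rfl⟩
      · exact mem_iUnion.2 ⟨Γ.src e, .inl rfl⟩)
  refine ⟨_, finite_touching T.finite_toSet, fun e he t ht h => he ?_⟩
  obtain ⟨v, hv, h'⟩ := mem_iUnion₂.1 (hT h)
  exact (touches_of_param_mem_star ht h').imp (fun h => by rw [mem_singleton_iff.1 h]; exact hv)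
    fun h => by rw [mem_singleton_iff.1 h]; exact hv

lemma exists_edge_of_adj {u v : V} (h : Γ.graph.Adj u v) : ∃ e : Γ.Edge, (e : Sym2 V) = s(u, v) ∧
    (Γ.src e = u ∧ Γ.tgt e = v ∨ Γ.src e = v ∧ Γ.tgt e = u) :=
  ⟨⟨s(u, v), h⟩, rfl, Sym2.eq_iff.1 (Γ.mk_src_tgt ⟨s(u, v), h⟩)⟩

lemma adj_src_tgt (e : Γ.Edge) : Γ.graph.Adj (Γ.src e) (Γ.tgt e) := by
  rw [← SimpleGraph.mem_edgeSet, Γ.mk_src_tgt]; exact e.2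

lemma isPreconnected_param_image (e : Γ.Edge) {s : Set ℝ} (hs : s ⊆ Icc 0 (Γ.length e))
    (h : IsPreconnected s) : IsPreconnected (Γ.param e '' s) :=
  h.image _ ((continuousOn_param e).mono hs)

/-- Walks in `H` become connected unions of closed edges. An edge touching the component may leave
it at its other end, so its interior is attached by a half-open edge. -/
lemma isConnected_star_reachable {H : SimpleGraph V} (hH : H ≤ Γ.graph) (x : V) :
    IsConnected (star {u | H.Reachable x u} : Set Γ.Point) := by
  set C := {u | H.Reachable x u} with hC
  have hx : x ∈ C := SimpleGraph.Reachable.refl x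
  have hedge : ∀ e : Γ.Edge, Γ.src e ∈ C ∨ Γ.tgt e ∈ C → ∀ t ∈ Ioo 0 (Γ.length e),
      Γ.param e t ∈ (star C : Set Γ.Point) := fun e he t ht => by rwa [param_of_mem_Ioo e ht]
  have hvert : ∀ u ∈ C, ∃ s ⊆ (star C : Set Γ.Point), .vertex x ∈ s ∧ .vertex u ∈ s ∧
      IsPreconnected s := by
    intro u hu
    have hu' := (SimpleGraph.reachable_iff_reflTransGen x u).1 hu
    clear hu
    induction hu' with
    | refl => exact ⟨{.vertex x}, by simpa using hx, rfl, rfl, isPreconnected_singleton⟩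
    | @tail a b hab hadj ih =>
      obtain ⟨s, hs, hxs, has, hsc⟩ := ih
      have ha : a ∈ C := (SimpleGraph.reachable_iff_reflTransGen x a).2 hab
      have hb : b ∈ C := SimpleGraph.Reachable.trans ha hadj.reachable
      obtain ⟨e, he, hends⟩ := exists_edge_of_adj (hH hadj)
      have hsrc : Γ.src e ∈ C := by rcases hends with h | h <;> rw [h.1] <;> assumption
      have htgt : Γ.tgt e ∈ C := by rcases hends with h | h <;> rw [h.2] <;> assumption
      obtain ⟨ta, hta, hpa⟩ := exists_param_eq_vertex (e := e) (v := a) (by simp [he])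
      obtain ⟨tb, htb, hpb⟩ := exists_param_eq_vertex (e := e) (v := b) (by simp [he])
      refine ⟨s ∪ Γ.param e '' Icc 0 (Γ.length e), union_subset hs ?_, .inl hxs,
        .inr ⟨tb, htb, hpb⟩, IsPreconnected.union _ has ⟨ta, hta, hpa⟩ hsc
          (isPreconnected_param_image e Subset.rfl isPreconnected_Icc)⟩
      rintro _ ⟨t, ht, rfl⟩
      rcases Icc_cases ht with rfl | rfl | h0
      · rwa [param_zero]
      · rwa [param_length]
      · exact hedge e (.inl hsrc) t h0
  refine ⟨⟨.vertex x, hx⟩, isPreconnected_of_forall (.vertex x) fun p hp => ?_⟩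
  rcases p with u | ⟨e, t, ht⟩
  · obtain ⟨s, h1, h2, h3, h4⟩ := hvert u hp
    exact ⟨s, h1, h2, h3, h4⟩
  · have hI : Ioo 0 (Γ.length e) ⊆ Icc 0 (Γ.length e) := Ioo_subset_Icc_self
    rcases hp with h | h
    · obtain ⟨s, h1, h2, h3, h4⟩ := hvert _ h
      refine ⟨s ∪ Γ.param e '' Ico 0 (Γ.length e), union_subset h1 ?_, .inl h2,
        .inr ⟨t, ⟨ht.1.le, ht.2⟩, param_of_mem_Ioo e ht⟩,
        IsPreconnected.union _ h3 ⟨0, ⟨le_rfl, Γ.length_pos e⟩, param_zero e⟩ h4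
          (isPreconnected_param_image e Ico_subset_Icc_self isPreconnected_Ico)⟩
      rintro _ ⟨r, hr, rfl⟩
      rcases hr.1.eq_or_lt with rfl | h0
      · rwa [param_zero]
      · exact hedge e (.inl h) r ⟨h0, hr.2⟩
    · obtain ⟨s, h1, h2, h3, h4⟩ := hvert _ h
      refine ⟨s ∪ Γ.param e '' Ioc 0 (Γ.length e), union_subset h1 ?_, .inl h2,
        .inr ⟨t, ⟨ht.1, ht.2.le⟩, param_of_mem_Ioo e ht⟩,
        IsPreconnected.union _ h3 ⟨_, ⟨Γ.length_pos e, le_rfl⟩, param_length e⟩ h4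
          (isPreconnected_param_image e Ioc_subset_Icc_self isPreconnected_Ioc)⟩
      rintro _ ⟨r, hr, rfl⟩
      rcases hr.2.eq_or_lt with rfl | h0
      · rwa [param_length]
      · exact hedge e (.inr h) r ⟨hr.1, h0⟩

/-! ### Oscillation along paths -/

open Classical in
/-- A function on the vertices whose increments along the edges are bounded by `w` oscillates on a
connected subgraph by at most the sum of `w` over the edges of this subgraph. -/
lemma edist_le_tsum_of_reachable {H : SimpleGraph V} (hH : H ≤ Γ.graph) {a : V → ℝ}
    {w : Γ.Edge → ℝ≥0∞} (hw : ∀ e, edist (a (Γ.src e)) (a (Γ.tgt e)) ≤ w e) {u v : V}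
    (huv : H.Reachable u v) :
    edist (a u) (a v) ≤ ∑' e, indicator {e : Γ.Edge | (e : Sym2 V) ∈ H.edgeSet} w e := by
  set W : Sym2 V → ℝ≥0∞ := fun s => if h : s ∈ Γ.graph.edgeSet then w ⟨s, h⟩ else 0 with hW
  have hwalk : ∀ {x y : V} (p : H.Walk x y), edist (a x) (a y) ≤ (p.edges.map W).sum := by
    intro x y p
    induction p with
    | nil => simp
    | @cons x y z hxy p ih =>
      refine (edist_triangle _ (a y) _).trans ?_
      rw [SimpleGraph.Walk.edges_cons, List.map_cons, List.sum_cons]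
      refine add_le_add ?_ ih
      have h : s(x, y) ∈ Γ.graph.edgeSet := hH hxy
      simp only [hW, h, dif_pos]
      have h1 := hw ⟨s(x, y), h⟩
      rcases Sym2.eq_iff.1 (Γ.mk_src_tgt ⟨s(x, y), h⟩) with h2 | h2 <;> rw [h2.1, h2.2] at h1
      · exact h1
      · rwa [edist_comm]
  -- A path repeats no edge, so its sum is dominated by the sum over the subgraph.
  obtain ⟨p, hp⟩ := huv.exists_isPath
  refine (hwalk p).trans ?_
  rw [← List.sum_toFinset _ hp.isTrail.edges_nodup]
  calc ∑ s ∈ p.edges.toFinset, W s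
      = ∑ s ∈ p.edges.toFinset, indicator H.edgeSet W s := by
        refine Finset.sum_congr rfl fun s hs => (indicator_of_mem ?_ W).symm
        exact p.edges_subset_edgeSet (List.mem_toFinset.1 hs)
    _ ≤ ∑' s, indicator H.edgeSet W s := ENNReal.sum_le_tsum _
    _ = ∑' s, indicator Γ.graph.edgeSet (indicator H.edgeSet W) s := by
        rw [indicator_indicator, inter_eq_right.2 (SimpleGraph.edgeSet_mono hH)]
    _ = ∑' e : Γ.Edge, indicator H.edgeSet W e := (tsum_subtype Γ.graph.edgeSet _).symm
    _ = _ := by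
        refine tsum_congr fun e => ?_
        by_cases he : (e : Sym2 V) ∈ H.edgeSet <;> simp [indicator, he, hW]

/-! ### Sobolev functions on the metric graph -/

/-- The contribution of an edge to the squared `H¹` norm. -/
def weight (f : Γ.Point → ℂ) (e : Γ.Edge) : ℝ≥0∞ := sobolevSq (Γ.length e) (Γ.onEdge f e)

lemma l2NormSq_add_energy (f : Γ.Point → ℂ) : Γ.l2NormSq f + Γ.energy f = ∑' e, weight f e := by
  rw [l2NormSq, energy, ← ENNReal.tsum_add]
  exact tsum_congr fun e => (sobolevSq_eq_add _ _).symm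

lemma h1Norm_lt_rpow {f : Γ.Point → ℂ} {ε : ℝ≥0∞} :
    Γ.h1Norm f < ε ^ (1 / 2 : ℝ) ↔ ∑' e, weight f e < ε := by
  rw [h1Norm, l2NormSq_add_energy, ENNReal.rpow_lt_rpow_iff (by norm_num)]

lemma mem_H1_iff {f : Γ.Point → ℂ} : f ∈ Γ.H1 ↔ Continuous f ∧
    (∀ e, IntervalH1 (Γ.length e) (Γ.onEdge f e)) ∧ ∑' e, weight f e < ∞ := by
  rw [← l2NormSq_add_energy, ENNReal.add_lt_top, H1, mem_ofPred_eq]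
  tauto

lemma edist_norm_sq_le_weight {f : Γ.Point → ℂ} {e : Γ.Edge}
    (hf : AbsolutelyContinuousOnInterval (Γ.onEdge f e) 0 (Γ.length e)) {s t : ℝ}
    (hs : s ∈ Icc 0 (Γ.length e)) (ht : t ∈ Icc 0 (Γ.length e)) :
    edist (‖f (Γ.param e s)‖ ^ 2) (‖f (Γ.param e t)‖ ^ 2) ≤ weight f e :=
  edist_norm_sq_le_sobolevSq hf hs ht

lemma edist_vertex_norm_sq_le_weight {f : Γ.Point → ℂ} {e : Γ.Edge}
    (hf : AbsolutelyContinuousOnInterval (Γ.onEdge f e) 0 (Γ.length e)) :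
    edist (‖f (.vertex (Γ.src e))‖ ^ 2) (‖f (.vertex (Γ.tgt e))‖ ^ 2) ≤ weight f e := by
  simpa using edist_norm_sq_le_weight hf (zero_mem_Icc e) (length_mem_Icc e)

/-- The function with the given values at the vertices and in the interiors of the edges. -/
def glue (a : V → ℂ) (G : Γ.Edge → ℝ → ℂ) : Γ.Point → ℂ
  | .vertex v => a v
  | .inner e t _ => G e t

lemma onEdge_glue {a : V → ℂ} {G : Γ.Edge → ℝ → ℂ} {e : Γ.Edge} (h0 : G e 0 = a (Γ.src e))
    (hL : G e (Γ.length e) = a (Γ.tgt e)) :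
    EqOn (Γ.onEdge (glue a G) e) (G e) (Icc 0 (Γ.length e)) := by
  intro t ht
  rw [onEdge]
  rcases Icc_cases ht with rfl | rfl | h
  · rw [param_zero, h0]; rfl
  · rw [param_length, hL]; rfl
  · rw [param_of_mem_Ioo e h]; rfl

lemma exists_edge_mem [Nontrivial V] (v : V) : ∃ e : Γ.Edge, v ∈ (e : Sym2 V) := by
  obtain ⟨u, hu⟩ := Γ.connected.preconnected.exists_adj_of_nontrivial v
  obtain ⟨e, he, -⟩ := exists_edge_of_adj hu
  exact ⟨e, by simp [he]⟩

/-! ### Ends of finite volume -/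

/-- A closed edge is connected, so it cannot cross from `A` to its complement without meeting the
boundary. -/
lemma forall_mem_or_forall_notMem {A : Set Γ.Point} (hA : IsOpen A) {e : Γ.Edge}
    (he : ∀ t ∈ Icc 0 (Γ.length e), Γ.param e t ∉ frontier A) :
    (∀ t ∈ Icc 0 (Γ.length e), Γ.param e t ∈ A) ∨
      ∀ t ∈ Icc 0 (Γ.length e), Γ.param e t ∉ A := by
  by_contra! h
  obtain ⟨⟨s, hs, hsA⟩, t, ht, htA⟩ := h
  refine hsA ((isPreconnected_param_image e Subset.rfl
    isPreconnected_Icc).subset_of_closure_inter_subset hA ⟨_, ⟨t, ht, rfl⟩, htA⟩ ?_ ⟨s, hs, rfl⟩)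
  rintro _ ⟨hc, r, hr, rfl⟩
  by_contra hrA
  exact he r hr ⟨hc, by rwa [hA.interior_eq]⟩

/-- With finitely many vertices the set would meet only finitely many edges: those touching its
vertices and those meeting its compact boundary. The later closures would then be nested, nonempty
and compact, hence with nonempty intersection. -/
lemma EndSeq.infinite_vertices [Nontrivial V] (U : Γ.EndSeq) (n : ℕ) :
    {v : V | (.vertex v : Γ.Point) ∈ U.set n}.Infinite := by
  intro hfin
  obtain ⟨F, hF, hFK⟩ := exists_finite_edges_of_isCompact (U.isCompact_frontier n)
  set E : Set Γ.Edge := {e | ∃ t ∈ Icc 0 (Γ.length e), Γ.param e t ∈ U.set n} with hE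
  have hEfin : E.Finite := by
    refine (hF.union (finite_touching hfin)).subset fun e ⟨t, ht, hte⟩ => ?_
    by_cases he : e ∈ F
    · exact .inl he
    · refine .inr (.inl ?_)
      rcases forall_mem_or_forall_notMem (U.isOpen n) (hFK e he) with h | h
      · simpa using h 0 (zero_mem_Icc e)
      · exact (h t ht hte).elim
  have hsub : U.set n ⊆ edgeHull E := by
    rintro (v | ⟨e, t, ht⟩) hp
    · obtain ⟨e, he⟩ := exists_edge_mem (Γ := Γ) v
      obtain ⟨t, ht, hte⟩ := exists_param_eq_vertex he
      exact mem_edgeHull.2 ⟨e, ⟨t, ht, hte ▸ hp⟩, t, ht, hte⟩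
    · have hte := param_of_mem_Ioo e ht
      have ht' := Ioo_subset_Icc_self ht
      exact mem_edgeHull.2 ⟨e, ⟨t, ht', hte ▸ hp⟩, t, ht', hte⟩
  have hanti : Antitone U.set := antitone_nat_of_succ_le U.subset
  have hne := IsCompact.nonempty_iInter_of_sequence_nonempty_isCompact_isClosed
    (fun k => closure (U.set (n + k)))
    (fun k => closure_mono (hanti (by omega)))
    (fun k => (U.isConnected (n + k)).nonempty.closure)
    ((isCompact_edgeHull hEfin).of_isClosed_subset isClosed_closure
      (closure_minimal hsub (isClosed_edgeHull E)))
    (fun k => isClosed_closure)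
  obtain ⟨p, hp⟩ := hne
  have : p ∈ ⋂ k, closure (U.set k) := mem_iInter.2 fun k =>
    closure_mono (hanti (by omega)) (mem_iInter.1 hp k)
  rwa [U.iInter_closure] at this

open Classical in
/-- The function that is `1` at the vertices in `A`, `0` at the other vertices, and affine on the
edges. -/
def affineIndicator (A : Set Γ.Point) : Γ.Point → ℂ :=
  glue (fun v => if (.vertex v : Γ.Point) ∈ A then 1 else 0) fun e t =>
    (if (.vertex (Γ.src e) : Γ.Point) ∈ A then 1 else 0) +
      (t / Γ.length e : ℝ) • ((if (.vertex (Γ.tgt e) : Γ.Point) ∈ A then (1 : ℂ) else 0) -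
        if (.vertex (Γ.src e) : Γ.Point) ∈ A then 1 else 0)

open Classical in
lemma onEdge_affineIndicator (A : Set Γ.Point) (e : Γ.Edge) :
    EqOn (Γ.onEdge (affineIndicator A) e) (fun t =>
      (if (.vertex (Γ.src e) : Γ.Point) ∈ A then 1 else 0) +
      (t / Γ.length e : ℝ) • ((if (.vertex (Γ.tgt e) : Γ.Point) ∈ A then (1 : ℂ) else 0) -
        if (.vertex (Γ.src e) : Γ.Point) ∈ A then 1 else 0)) (Icc 0 (Γ.length e)) :=
  onEdge_glue (by simp) (by simp [(Γ.length_pos e).ne'])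

/-- Off the finitely many edges meeting the boundary the function is constantly 1 or 0, and its
squared norm on such an edge is the volume of `A` in that edge. -/
lemma affineIndicator_mem_H1 {A : Set Γ.Point} (hA : IsOpen A) (hfr : IsCompact (frontier A))
    (hvol : Γ.vol A < ∞) : affineIndicator A ∈ Γ.H1 := by
  obtain ⟨F, hF, hFK⟩ := exists_finite_edges_of_isCompact hfr
  have hsm : ∀ (e : Γ.Edge) (a b : ℂ), ContDiff ℝ 1 fun t : ℝ => a + (t / Γ.length e : ℝ) • b :=
    fun e a b => contDiff_const.add ((contDiff_id.div_const _).smul contDiff_const)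
  have hH1 : ∀ e, IntervalH1 (Γ.length e) (Γ.onEdge (affineIndicator A) e) := fun e =>
    (intervalH1_of_contDiff (hsm e _ _)).congr (Γ.length_pos e).le
      (onEdge_affineIndicator A e).symm
  refine mem_H1_iff.2 ⟨continuous_iff.2 fun e =>
    (hsm e _ _).continuous.continuousOn.congr (onEdge_affineIndicator A e), hH1, ?_⟩
  have hle : ∀ e, weight (affineIndicator A) e ≤ indicator F (weight (affineIndicator A)) e +
      volume {t : ℝ | t ∈ Icc 0 (Γ.length e) ∧ Γ.param e t ∈ A} := by
    intro e
    by_cases he : e ∈ F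
    · rw [indicator_of_mem he]; exact le_self_add
    refine le_add_of_le_right ?_
    have hO := (onEdge_affineIndicator A e).mono Ioo_subset_Icc_self
    rcases forall_mem_or_forall_notMem hA (hFK e he) with h | h
    · have h0 := h 0 (zero_mem_Icc e)
      have h1 := h _ (length_mem_Icc e)
      rw [param_zero] at h0
      rw [param_length] at h1
      simp only [h0, h1, if_true, sub_self, smul_zero, add_zero] at hO
      have hset : {t : ℝ | t ∈ Icc 0 (Γ.length e) ∧ Γ.param e t ∈ A} = Icc 0 (Γ.length e) := by
        ext t; exact ⟨fun h => h.1, fun ht => ⟨ht, h t ht⟩⟩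
      rw [weight, sobolevSq_congr hO, sobolevSq, hset]
      simp
    · have h0 := h 0 (zero_mem_Icc e)
      have h1 := h _ (length_mem_Icc e)
      rw [param_zero] at h0
      rw [param_length] at h1
      simp only [h0, h1, if_false, sub_self, smul_zero, add_zero] at hO
      rw [weight, sobolevSq_congr hO, sobolevSq]
      simp
  refine (ENNReal.tsum_le_tsum hle).trans_lt ?_
  rw [ENNReal.tsum_add]
  refine ENNReal.add_lt_top.2 ⟨?_, hvol⟩
  rw [tsum_eq_sum (s := hF.toFinset) fun e he =>
    indicator_of_notMem (by simpa using he) _]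
  refine ENNReal.sum_lt_top.2 fun e he => ?_
  rw [indicator_of_mem (by simpa using he)]
  exact (hH1 e).sobolevSq_lt_top (Γ.length_pos e).le

lemma notMem_H10_of_infinite_vertices [Infinite V] {f : Γ.Point → ℂ}
    (hf : {v : V | f (.vertex v) = 1}.Infinite) : f ∉ Γ.H10 := by
  rintro ⟨hfH, happ⟩
  obtain ⟨e₀, -⟩ := exists_edge_mem (Γ := Γ) (Classical.arbitrary V)
  set L := Γ.length e₀ with hL
  have hLpos : 0 < L := Γ.length_pos e₀
  -- Two oscillations of at most 1/4, one along a path to `e₀` and one along `e₀`, leave |f - g|² ≥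
  -- 1/2 there; the resulting norm L/2 exceeds L/4.
  set ε : ℝ := min (1 / 4) (L / 4) with hε
  have hεpos : 0 < ε := by positivity
  obtain ⟨g, ⟨hgH2, hgfin, -, -⟩, hg⟩ := happ (ENNReal.ofReal ε ^ (1 / 2 : ℝ))
    (ENNReal.rpow_pos (by simpa using hεpos) (by simp))
  rw [h1Norm_lt_rpow] at hg
  have hac : ∀ e, AbsolutelyContinuousOnInterval (Γ.onEdge (f - g) e) 0 (Γ.length e) := fun e =>
    ((mem_H1_iff.1 hfH).2.1 e).1.sub (hgH2 e).1.1
  have hfin : {v : V | g (.vertex v) ≠ 0}.Finite := by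
    refine (hgfin.biUnion (t := fun e => {v | v ∈ (e : Sym2 V)}) fun e _ => ?_).subset
      fun v hv => ?_
    · exact (toFinite {Γ.src e, Γ.tgt e}).subset fun v hv => mem_edge_iff.1 hv
    · obtain ⟨e, he⟩ := exists_edge_mem (Γ := Γ) v
      obtain ⟨t, ht, hte⟩ := exists_param_eq_vertex he
      exact mem_iUnion₂.2 ⟨e, ⟨t, ht, by rw [onEdge, hte]; exact hv⟩, he⟩
  obtain ⟨v, hv, hgv⟩ := (hf.sdiff hfin).nonempty
  have hgv' : g (.vertex v) = 0 := not_not.1 hgv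
  have hv1 : ‖(f - g) (.vertex v)‖ ^ 2 = 1 := by
    simp [hgv', show f (.vertex v) = 1 from hv]
  have hw : ∀ e, weight (f - g) e ≤ ENNReal.ofReal ε := fun e => (ENNReal.le_tsum e).trans hg.le
  have hsrc : dist (‖(f - g) (.vertex v)‖ ^ 2) (‖(f - g) (.vertex (Γ.src e₀))‖ ^ 2) ≤ ε := by
    refine (edist_le_ofReal hεpos.le).1 (le_trans ?_ hg.le)
    refine (edist_le_tsum_of_reachable (a := fun v => ‖(f - g) (.vertex v)‖ ^ 2) le_rfl
      (fun e => edist_vertex_norm_sq_le_weight (hac e)) (Γ.connected.preconnected v _)).trans ?_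
    exact ENNReal.tsum_le_tsum fun e => indicator_le_self _ _ _
  have hlow : ∀ t ∈ Icc 0 L, 1 / 2 ≤ ‖(f - g) (Γ.param e₀ t)‖ ^ 2 := by
    intro t ht
    have h := (edist_le_ofReal hεpos.le).1
      ((edist_norm_sq_le_weight (hac e₀) (zero_mem_Icc e₀) ht).trans (hw e₀))
    rw [param_zero] at h
    rw [hv1] at hsrc
    rw [Real.dist_eq, abs_le] at h hsrc
    have : ε ≤ 1 / 4 := min_le_left _ _
    linarith [h.2, hsrc.2]
  have hbig : ENNReal.ofReal (L / 2) ≤ weight (f - g) e₀ := by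
    calc ENNReal.ofReal (L / 2) = ∫⁻ _ in Ioo 0 L, ENNReal.ofReal (1 / 2) := by
          simp only [lintegral_const, Measure.restrict_apply, MeasurableSet.univ, univ_inter,
            Real.volume_Ioo, sub_zero]
          rw [← ENNReal.ofReal_mul (by norm_num)]
          congr 1; ring
      _ ≤ _ := by
          refine setLIntegral_mono_ae' measurableSet_Ioo (.of_forall fun t ht => ?_)
          refine le_add_of_le_left ?_
          rw [← ofReal_norm, ← ENNReal.ofReal_pow (norm_nonneg _)]
          exact ENNReal.ofReal_le_ofReal (hlow t (Ioo_subset_Icc_self ht))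
  have := hbig.trans (hw e₀)
  rw [ENNReal.ofReal_le_ofReal_iff hεpos.le] at this
  have : ε ≤ L / 4 := min_le_right _ _
  linarith

lemma hasInfiniteVolume_of_H1_eq_H10 [Infinite V] (h : Γ.H1 = Γ.H10) (γ : Γ.TopEnd) :
    γ.HasInfiniteVolume := by
  rintro ⟨U, -, n, hn⟩
  refine notMem_H10_of_infinite_vertices (f := affineIndicator (U.set n))
    ((U.infinite_vertices n).mono fun v hv => if_pos hv)
    (h ▸ affineIndicator_mem_H1 (U.isOpen n) (U.isCompact_frontier n) hn)

/-! ### Construction of ends -/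

/-- The graph obtained by deleting all edges incident to a set of vertices. -/
def avoid (G : SimpleGraph V) (K : Set V) : SimpleGraph V where
  Adj x y := G.Adj x y ∧ x ∉ K ∧ y ∉ K
  symm := ⟨fun _ _ h => ⟨h.1.symm, h.2.2, h.2.1⟩⟩
  loopless := ⟨fun _ h => h.1.ne rfl⟩

lemma avoid_le (G : SimpleGraph V) (K : Set V) : avoid G K ≤ G := fun _ _ h => h.1

lemma avoid_anti (G : SimpleGraph V) {K K' : Set V} (h : K ⊆ K') : avoid G K' ≤ avoid G K :=
  fun _ _ hxy => ⟨hxy.1, fun hx => hxy.2.1 (h hx), fun hy => hxy.2.2 (h hy)⟩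

lemma notMem_of_reachable_avoid {G : SimpleGraph V} {K : Set V} {x u : V} (hx : x ∉ K)
    (h : (avoid G K).Reachable x u) : u ∉ K := by
  rw [SimpleGraph.reachable_iff_reflTransGen] at h
  rcases h.cases_tail with rfl | ⟨y, -, hy⟩
  · exact hx
  · exact hy.2.2

/-- Follow a walk from `v` to `k` until just before it first enters `K`. For finite `K` this leaves
only finitely many components outside `K`, as there are finitely many neighbours. -/
lemma exists_adj_reachable_avoid {G : SimpleGraph V} {K : Set V} {k v : V} (hk : k ∈ K)
    (hkv : G.Reachable v k) (hv : v ∉ K) :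
    ∃ x ∉ K, (∃ y ∈ K, G.Adj x y) ∧ (avoid G K).Reachable x v := by
  rw [SimpleGraph.reachable_iff_reflTransGen] at hkv
  induction hkv using Relation.ReflTransGen.head_induction_on with
  | refl => exact (hv hk).elim
  | @head a b hab _ ih =>
    by_cases hb : b ∈ K
    · exact ⟨a, hv, ⟨b, hb, hab⟩, SimpleGraph.Reachable.refl a⟩
    · obtain ⟨x, hx, hxK, hxb⟩ := ih hb
      have hba : (avoid G K).Adj b a := ⟨hab.symm, hb, hv⟩
      exact ⟨x, hx, hxK, hxb.trans hba.reachable⟩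

lemma finite_neighbors {K : Set V} (hK : K.Finite) :
    {x : V | ∃ y ∈ K, Γ.graph.Adj x y}.Finite := by
  refine ((finite_touching (Γ := Γ) hK).biUnion fun e _ =>
    toFinite {Γ.src e, Γ.tgt e}).subset ?_
  rintro x ⟨y, hy, hxy⟩
  obtain ⟨e, he, h⟩ := exists_edge_of_adj hxy
  refine mem_iUnion₂.2 ⟨e, ?_, ?_⟩
  · exact h.symm.imp (fun h => by rwa [h.1]) fun h => by rwa [h.2]
  · exact h.imp (fun h => h.1.symm) fun h => h.2.symm

/-- The components outside `K` form a finite cover of a cofinite set, so the ultrafilter contains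
one of them. -/
lemma exists_component_mem_ultrafilter (𝒰 : Ultrafilter V) (h𝒰 : (𝒰 : Filter V) ≤ cofinite)
    {K : Set V} (hK : K.Finite) (hne : K.Nonempty) :
    ∃ x ∉ K, {u | (avoid Γ.graph K).Reachable x u} ∈ 𝒰 := by
  obtain ⟨k, hk⟩ := hne
  have hmem : (⋃ x ∈ {x : V | ∃ y ∈ K, Γ.graph.Adj x y} \ K,
      {u | (avoid Γ.graph K).Reachable x u}) ∈ 𝒰 := by
    refine mem_of_superset (h𝒰 hK.compl_mem_cofinite) fun v hv => ?_
    obtain ⟨x, hx, hxK, hxv⟩ := exists_adj_reachable_avoid hk (Γ.connected.preconnected v k) hv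
    exact mem_iUnion₂.2 ⟨x, ⟨hxK, hx⟩, hxv⟩
  obtain ⟨x, hx, hxU⟩ :=
    (Ultrafilter.finite_biUnion_mem_iff ((finite_neighbors hK).subset sdiff_subset)).1 hmem
  exact ⟨x, hx.2, hxU⟩

lemma closure_star_subset [Nontrivial V] (C : Set V) :
    closure (star C : Set Γ.Point) ⊆ edgeHull {e | Γ.src e ∈ C ∨ Γ.tgt e ∈ C} := by
  refine closure_minimal ?_ (isClosed_edgeHull _)
  rintro (v | ⟨e, t, ht⟩) hp
  · obtain ⟨e, he⟩ := exists_edge_mem (Γ := Γ) v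
    obtain ⟨t, ht, hte⟩ := exists_param_eq_vertex he
    exact mem_edgeHull.2 ⟨e, touches_of_param_mem_star ht (hte ▸ hp), t, ht, hte⟩
  · exact mem_edgeHull.2 ⟨e, hp, t, Ioo_subset_Icc_self ht, param_of_mem_Ioo e ht⟩

/-- The boundary lies in the finite set of vertices `K`: a boundary point is a vertex outside the
component but adjacent to it. -/
lemma isCompact_frontier_star [Nontrivial V] {K : Set V} (hK : K.Finite) {x : V} (hx : x ∉ K) :
    IsCompact (frontier (star {u | (avoid Γ.graph K).Reachable x u} : Set Γ.Point)) := by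
  set C := {u | (avoid Γ.graph K).Reachable x u} with hC
  have hadj : ∀ a b, a ∈ C → b ∉ C → Γ.graph.Adj a b → b ∈ K := by
    intro a b ha hb hab
    by_contra hbK
    have hab' : (avoid Γ.graph K).Adj a b := ⟨hab, notMem_of_reachable_avoid hx ha, hbK⟩
    exact hb (SimpleGraph.Reachable.trans ha hab'.reachable)
  refine ((hK.image Point.vertex).subset fun p hp => ?_).isCompact
  have hpC : p ∉ (star C : Set Γ.Point) := by
    have := hp.2
    rwa [(isOpen_star C).interior_eq] at this
  obtain ⟨e, he, t, ht, rfl⟩ := mem_edgeHull.1 (closure_star_subset C hp.1)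
  rcases Icc_cases ht with rfl | rfl | h0
  · rw [param_zero] at hpC ⊢
    exact ⟨_, hadj _ _ (he.resolve_left hpC) hpC (adj_src_tgt e).symm, rfl⟩
  · rw [param_length] at hpC ⊢
    exact ⟨_, hadj _ _ (he.resolve_right hpC) hpC (adj_src_tgt e), rfl⟩
  · rw [param_of_mem_Ioo e h0] at hpC
    exact (hpC he).elim

/-- Every infinite set of vertices accumulates at some end, which is given by a sequence of open
stars of connected sets of vertices. -/
lemma exists_endSeq_of_infinite [Countable V] [Infinite V] {S : Set V} (hS : S.Infinite) :
    ∃ (U : Γ.EndSeq) (C : ℕ → Set V) (H : ℕ → SimpleGraph V), (∀ n, U.set n = star (C n)) ∧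
      (∀ n, (S ∩ C n).Nonempty) ∧ (∀ n, H n ≤ Γ.graph) ∧
      (∀ n, ∀ u ∈ C n, ∀ v ∈ C n, (H n).Reachable u v) ∧
      ∀ F : Set Γ.Edge, F.Finite → ∃ n, ∀ e ∈ F, (e : Sym2 V) ∉ (H n).edgeSet ∧
        ¬ (Γ.src e ∈ C n ∨ Γ.tgt e ∈ C n) := by
  obtain ⟨ν, hν⟩ := exists_surjective_nat V
  set K : ℕ → Set V := fun n => ν '' Iic n with hKdef
  have hKfin : ∀ n, (K n).Finite := fun n => (finite_Iic n).image ν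
  have hKne : ∀ n, (K n).Nonempty := fun n => ⟨ν 0, 0, Nat.zero_le n, rfl⟩
  have hKmono : ∀ n, K n ⊆ K (n + 1) := fun n => image_mono (Iic_subset_Iic.2 n.le_succ)
  have hKex : ∀ T : Set V, T.Finite → ∃ n, T ⊆ K n := by
    intro T hT
    have : ∀ᶠ n in atTop, ∀ v ∈ T, v ∈ K n := by
      rw [eventually_all_finite hT]
      intro v _
      obtain ⟨i, rfl⟩ := hν v
      filter_upwards [eventually_ge_atTop i] with n hn
      exact ⟨i, hn, rfl⟩
    exact this.exists
  have := hS.cofinite_inf_principal_neBot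
  -- A single ultrafilter makes all choices coherent: consecutive components both belong to it,
  -- hence meet and are nested, and each meets `S`.
  obtain ⟨𝒰, h𝒰⟩ := Ultrafilter.exists_le (cofinite ⊓ 𝓟 S)
  have hSU : S ∈ 𝒰 := h𝒰 (mem_inf_of_right (mem_principal_self S))
  choose x hxK hxU using fun n => exists_component_mem_ultrafilter (Γ := Γ) 𝒰
    (h𝒰.trans inf_le_left) (hKfin n) (hKne n)
  set C : ℕ → Set V := fun n => {u | (avoid Γ.graph (K n)).Reachable (x n) u} with hCdef
  have hCK : ∀ n, ∀ u ∈ C n, u ∉ K n := fun n u hu => notMem_of_reachable_avoid (hxK n) hu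
  have hsub : ∀ n, C (n + 1) ⊆ C n := by
    intro n u hu
    obtain ⟨w, hw, hw'⟩ := Ultrafilter.nonempty_of_mem (inter_mem (hxU n) (hxU (n + 1)))
    have h : (avoid Γ.graph (K (n + 1))).Reachable w u := SimpleGraph.Reachable.trans hw'.symm hu
    exact SimpleGraph.Reachable.trans hw (h.mono (avoid_anti _ (hKmono n)))
  have hends : ∀ (F : Set Γ.Edge), F.Finite → ∃ n, ∀ e ∈ F, Γ.src e ∈ K n ∧ Γ.tgt e ∈ K n := by
    intro F hF
    obtain ⟨n, hn⟩ := hKex _ (hF.biUnion fun e _ => toFinite {Γ.src e, Γ.tgt e})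
    exact ⟨n, fun e he => ⟨hn (mem_iUnion₂.2 ⟨e, he, .inl rfl⟩),
      hn (mem_iUnion₂.2 ⟨e, he, .inr rfl⟩)⟩⟩
  let U : Γ.EndSeq :=
    { set := fun n => star (C n)
      isOpen := fun n => isOpen_star _
      isConnected := fun n => isConnected_star_reachable (avoid_le _ _) _
      isCompact_frontier := fun n => isCompact_frontier_star (hKfin n) (hxK n)
      subset := fun n => by
        rintro (v | ⟨e, t, ht⟩) hp
        · exact hsub n hp
        · exact hp.imp (fun h => hsub n h) fun h => hsub n h
      iInter_closure := by
        refine eq_empty_of_forall_notMem fun p hp => ?_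
        have hmem : ∀ n, ∃ e, (Γ.src e ∈ C n ∨ Γ.tgt e ∈ C n) ∧
            ∃ t ∈ Icc 0 (Γ.length e), Γ.param e t = p := fun n =>
          mem_edgeHull.1 (closure_star_subset _ (mem_iInter.1 hp n))
        -- A point lies on finitely many edges. Once `K n` contains all their endpoints, none of
        -- them touches `C n`, so the point is outside the closure.
        obtain ⟨F, hF, hFp⟩ : ∃ F : Set Γ.Edge, F.Finite ∧
            ∀ e, ∀ t ∈ Icc 0 (Γ.length e), Γ.param e t = p → e ∈ F := by
          rcases p with v | ⟨e, t, ht⟩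
          · exact ⟨_, Γ.locallyFinite v, fun e t ht h => mem_edge_of_param_eq_vertex ht h⟩
          · refine ⟨{e}, finite_singleton e, fun e' s hs h => ?_⟩
            rcases Icc_cases hs with rfl | rfl | h0
            · rw [param_zero] at h; cases h
            · rw [param_length] at h; cases h
            · rw [param_of_mem_Ioo e' h0] at h; cases h; rfl
        obtain ⟨n, hn⟩ := hends F hF
        obtain ⟨e, he, t, ht, hte⟩ := hmem n
        have h := hn e (hFp e t ht hte)
        exact he.elim (fun h' => hCK n _ h' h.1) fun h' => hCK n _ h' h.2 }
  refine ⟨U, C, fun n => avoid Γ.graph (K n), fun n => rfl,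
    fun n => Ultrafilter.nonempty_of_mem (inter_mem hSU (hxU n)), fun n => avoid_le _ _,
    fun n u hu v hv => SimpleGraph.Reachable.trans (SimpleGraph.Reachable.symm hu) hv,
    fun F hF => ?_⟩
  obtain ⟨n, hn⟩ := hends F hF
  refine ⟨n, fun e he => ⟨fun h => ?_, ?_⟩⟩
  · rw [← Γ.mk_src_tgt e] at h
    exact h.2.1 (hn e he).1
  · rintro (h | h)
    · exact hCK n _ h (hn e he).1
    · exact hCK n _ h (hn e he).2

/-! ### Vanishing at infinity of H¹ functions. -/

/-- Chebyshev's inequality on the edges touching `C`. -/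
lemma vol_star_le {C : Set V} {f : Γ.Point → ℂ} {c : ℝ} (hc : 0 < c)
    (h : ∀ e : Γ.Edge, Γ.src e ∈ C ∨ Γ.tgt e ∈ C → ∀ t ∈ Icc 0 (Γ.length e),
      c ≤ ‖f (Γ.param e t)‖ ^ 2) :
    Γ.vol (star C) ≤ ENNReal.ofReal c⁻¹ * ∑' e, weight f e := by
  rw [vol, ← ENNReal.tsum_mul_left]
  refine ENNReal.tsum_le_tsum fun e => ?_
  by_cases he : Γ.src e ∈ C ∨ Γ.tgt e ∈ C
  · calc _ ≤ volume (Icc 0 (Γ.length e)) := measure_mono fun t ht => ht.1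
      _ = ENNReal.ofReal c⁻¹ * ∫⁻ _ in Ioo 0 (Γ.length e), ENNReal.ofReal c := by
          simp only [lintegral_const, Measure.restrict_apply, MeasurableSet.univ, univ_inter,
            Real.volume_Ioo, Real.volume_Icc, sub_zero]
          rw [← mul_assoc, ← ENNReal.ofReal_mul (by positivity), inv_mul_cancel₀ hc.ne',
            ENNReal.ofReal_one, one_mul]
      _ ≤ _ := by
          refine mul_le_mul_right (setLIntegral_mono_ae' measurableSet_Ioo
            (.of_forall fun t ht => le_add_of_le_left ?_)) _
          rw [← ofReal_norm, ← ENNReal.ofReal_pow (norm_nonneg _)]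
          exact ENNReal.ofReal_le_ofReal (h e he t (Ioo_subset_Icc_self ht))
  · have : {t : ℝ | t ∈ Icc 0 (Γ.length e) ∧ Γ.param e t ∈ star C} = ∅ :=
      eq_empty_of_forall_notMem fun t ht => he (touches_of_param_mem_star ht.1 ht.2)
    rw [this]
    simp

/-- If all ends have infinite volume, then every function in `H¹` vanishes at infinity. -/
lemma finite_edges_norm_sq_ge [Countable V] [Infinite V]
    (hends : ∀ γ : Γ.TopEnd, γ.HasInfiniteVolume) {f : Γ.Point → ℂ} (hf : f ∈ Γ.H1) {c : ℝ}
    (hc : 0 < c) :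
    {e : Γ.Edge | ∃ t ∈ Icc 0 (Γ.length e), c ≤ ‖f (Γ.param e t)‖ ^ 2}.Finite := by
  by_contra hinf
  obtain ⟨-, hH1, hfin⟩ := mem_H1_iff.1 hf
  have hlt : ∀ {a b d : ℝ} {w : ℝ≥0∞}, 0 < d → edist a b ≤ w → w < ENNReal.ofReal d →
      |a - b| < d := by
    intro a b d w hd h1 h2
    have := h1.trans_lt h2
    rwa [edist_dist, ENNReal.ofReal_lt_ofReal_iff hd, Real.dist_eq] at this
  -- All but finitely many edges have weight below c/2, and on these a value at least c passes to
  -- the initial vertex as a value at least c/2.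
  set S : Set V := {v | c / 2 ≤ ‖f (.vertex v)‖ ^ 2} with hSdef
  have hS : S.Infinite := by
    intro hSfin
    refine hinf (((ENNReal.finite_const_le_of_tsum_ne_top hfin.ne
      (ε := ENNReal.ofReal (c / 2)) (by simpa using hc)).union (finite_touching hSfin)).subset ?_)
    rintro e ⟨t, ht, hct⟩
    by_cases he : ENNReal.ofReal (c / 2) ≤ weight f e
    · exact .inl he
    · refine .inr (.inl ?_)
      have := hlt (half_pos hc) (edist_norm_sq_le_weight (hH1 e).1 ht (zero_mem_Icc e))
        (not_le.1 he)
      rw [param_zero, abs_lt] at this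
      change c / 2 ≤ _
      linarith [this.2]
  obtain ⟨U, C, H, hUC, hSC, hHle, hreach, hfar⟩ := exists_endSeq_of_infinite (Γ := Γ) hS
  -- Beyond a finite set of edges the total weight is below c/8, so moving from c/2 at one vertex
  -- leaves 3c/8 at every vertex of the component and c/4 on the touching edges.
  have h8 : 0 < c / 8 := by positivity
  obtain ⟨F, hF⟩ := ((ENNReal.tendsto_tsum_compl_atTop_zero hfin.ne).eventually_lt_const
    (u := ENNReal.ofReal (c / 8)) (by simpa using hc)).exists
  obtain ⟨n, hn⟩ := hfar F F.finite_toSet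
  obtain ⟨v, hvS, hvC⟩ := hSC n
  have hvert : ∀ u ∈ C n, c * (3 / 8) ≤ ‖f (.vertex u)‖ ^ 2 := by
    intro u hu
    have hle : (∑' e, indicator {e : Γ.Edge | (e : Sym2 V) ∈ (H n).edgeSet} (weight f) e) ≤
        ∑' e : {e // e ∉ F}, weight f e := by
      have : (∑' e : {e // e ∉ F}, weight f e) = ∑' e, indicator {e | e ∉ F} (weight f) e :=
        tsum_subtype {e | e ∉ F} (weight f)
      rw [this]
      refine ENNReal.tsum_le_tsum fun e => indicator_le_indicator_of_subset (fun e he heF => ?_)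
        (fun _ => zero_le) e
      exact (hn e heF).1 he
    have := hlt h8 ((edist_le_tsum_of_reachable (a := fun v => ‖f (.vertex v)‖ ^ 2) (hHle n)
      (fun e => edist_vertex_norm_sq_le_weight (hH1 e).1) (hreach n v hvC u hu)).trans hle) hF
    have hv' : c / 2 ≤ ‖f (.vertex v)‖ ^ 2 := hvS
    rw [abs_lt] at this
    linarith [this.2]
  have hedge : ∀ e : Γ.Edge, Γ.src e ∈ C n ∨ Γ.tgt e ∈ C n → ∀ t ∈ Icc 0 (Γ.length e),
      c / 4 ≤ ‖f (Γ.param e t)‖ ^ 2 := by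
    intro e he t ht
    have heF : e ∉ F := fun h => (hn e h).2 he
    have hw : weight f e < ENNReal.ofReal (c / 8) :=
      (ENNReal.le_tsum (f := fun e : {e // e ∉ F} => weight f e) ⟨e, heF⟩).trans_lt hF
    rcases he with he | he
    · have := hlt h8 (edist_norm_sq_le_weight (hH1 e).1 (zero_mem_Icc e) ht) hw
      rw [param_zero, abs_lt] at this
      linarith [this.2, hvert _ he]
    · have := hlt h8 (edist_norm_sq_le_weight (hH1 e).1 (length_mem_Icc e) ht) hw
      rw [param_length, abs_lt] at this
      linarith [this.2, hvert _ he]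
  refine hends (Quotient.mk _ U) ⟨U, rfl, n, ?_⟩
  rw [hUC]
  exact (vol_star_le (by positivity) hedge).trans_lt (ENNReal.mul_lt_top (by simp) hfin)

/-! ### Approximation by functions in the domain of the pre-minimal Laplacian -/

/-- Dominated convergence again, now for the counting measure on edges with summable majorant 9 ·
`weight f`. -/
lemma tendsto_tsum_weight_truncate [Countable V] {f : Γ.Point → ℂ} (hf : f ∈ Γ.H1) :
    Tendsto (fun n : ℕ => ∑' e, weight (truncate (1 / ((n : ℝ) + 1)) ∘ f) e) atTop (𝓝 0) := by
  obtain ⟨-, hH1, hfin⟩ := mem_H1_iff.1 hf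
  let _ : MeasurableSpace Γ.Edge := ⊤
  have := tendsto_lintegral_of_dominated_convergence (μ := Measure.count)
    (F := fun (n : ℕ) e => weight (truncate (1 / ((n : ℝ) + 1)) ∘ f) e) (f := fun _ => 0)
    (fun e => 9 * weight f e) (fun n => measurable_from_top)
    (fun n => .of_forall fun e => sobolevSq_truncate_comp_le (Γ.length_pos e).le
      (by positivity) (hH1 e))
    (by rw [lintegral_count, ENNReal.tsum_mul_left]
        exact ENNReal.mul_ne_top (by norm_num) hfin.ne)
    (.of_forall fun e => tendsto_sobolevSq_truncate_comp (Γ.length_pos e).le (hH1 e))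
  simpa only [lintegral_count, lintegral_zero, tsum_zero] using this

/-- The Kirchhoff condition will hold term by term, so no balancing between edges is needed. -/
lemma outwardDeriv_eq_zero {f : Γ.Point → ℂ} {e : Γ.Edge} {G : ℝ → ℂ}
    (hfG : EqOn (Γ.onEdge f e) G (Icc 0 (Γ.length e))) (hG : Differentiable ℝ G)
    (h0 : deriv G 0 = 0) (hL : deriv G (Γ.length e) = 0) (v : V) : Γ.outwardDeriv f e v = 0 := by
  have h : ∀ t ∈ Icc 0 (Γ.length e),
      derivWithin (Γ.onEdge f e) (Icc 0 (Γ.length e)) t = deriv G t := fun t ht => by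
    rw [derivWithin_congr hfG (hfG ht),
      (hG t).derivWithin (uniqueDiffOn_Icc (Γ.length_pos e) t ht)]
  rw [outwardDeriv, h _ (zero_mem_Icc e), h _ (length_mem_Icc e), h0, hL]
  simp

/-- A function in `H¹` which is non-zero only on finitely many edges can be approximated edgewise
by functions in the domain of the pre-minimal Laplacian. -/
lemma exists_mem_domPreminimal_approx {φ : Γ.Point → ℂ}
    (hφ : ∀ e, IntervalH1 (Γ.length e) (Γ.onEdge φ e)) {F : Set Γ.Edge} (hF : F.Finite)
    (hφF : ∀ e ∉ F, ∀ t ∈ Icc 0 (Γ.length e), φ (Γ.param e t) = 0)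
    {δ : Γ.Edge → ℝ≥0∞} (hδ : ∀ e, 0 < δ e) :
    ∃ g ∈ Γ.domPreminimal, ∀ e, sobolevSq (Γ.length e) (Γ.onEdge φ e - Γ.onEdge g e) ≤ δ e := by
  have hex : ∀ e, ∃ G : ℝ → ℂ, ContDiff ℝ 2 G ∧ G 0 = φ (.vertex (Γ.src e)) ∧
      G (Γ.length e) = φ (.vertex (Γ.tgt e)) ∧ deriv G 0 = 0 ∧ deriv G (Γ.length e) = 0 ∧
      sobolevSq (Γ.length e) (Γ.onEdge φ e - G) ≤ δ e ∧ (e ∉ F → G = 0) := by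
    intro e
    by_cases he : e ∈ F
    · obtain ⟨G, h1, h2, h3, h4, h5, h6⟩ := (hφ e).exists_smooth_approx (Γ.length_pos e) (hδ e)
      rw [onEdge, param_zero] at h2
      rw [onEdge, param_length] at h3
      exact ⟨G, h1, h2, h3, h4, h5, h6, fun h => (h he).elim⟩
    · have h0 := hφF e he 0 (zero_mem_Icc e)
      have hL := hφF e he _ (length_mem_Icc e)
      rw [param_zero] at h0
      rw [param_length] at hL
      have hz : EqOn (Γ.onEdge φ e - 0) 0 (Ioo 0 (Γ.length e)) := fun t ht => by
        simp [onEdge, hφF e he t (Ioo_subset_Icc_self ht)]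
      refine ⟨0, contDiff_const, h0.symm, hL.symm, by simp, by simp, ?_, fun _ => rfl⟩
      rw [sobolevSq_congr hz, sobolevSq]
      simp
  choose G hG2 hG0 hGL hd0 hdL hGδ hGF using hex
  set g : Γ.Point → ℂ := glue (fun v => φ (.vertex v)) G with hg
  have hgG : ∀ e, EqOn (Γ.onEdge g e) (G e) (Icc 0 (Γ.length e)) := fun e =>
    onEdge_glue (hG0 e) (hGL e)
  refine ⟨g, ⟨fun e => (intervalH2_of_contDiff (hG2 e)).congr (Γ.length_pos e).le (hgG e).symm,
    hF.subset fun e ⟨t, ht, hne⟩ => ?_, continuous_iff.2 fun e =>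
      (hG2 e).continuous.continuousOn.congr (hgG e), fun v => Finset.sum_eq_zero fun e _ =>
      outwardDeriv_eq_zero (hgG e) ((hG2 e).differentiable (by norm_num)) (hd0 e) (hdL e) v⟩,
    fun e => ?_⟩
  · by_contra he
    rw [hgG e ht, hGF e he] at hne
    exact hne rfl
  · refine (sobolevSq_congr fun t ht => ?_).trans_le (hGδ e)
    simp [hgG e (Ioo_subset_Icc_self ht)]

lemma H1_eq_H10_of_hasInfiniteVolume [Countable V] [Infinite V]
    (hends : ∀ γ : Γ.TopEnd, γ.HasInfiniteVolume) : Γ.H1 = Γ.H10 := by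
  refine Subset.antisymm (fun f hf => ⟨hf, fun ε hε => ?_⟩) fun f hf => hf.1
  obtain ⟨-, hH1, -⟩ := mem_H1_iff.1 hf
  have hεsq : ε = (ε ^ 2) ^ (1 / 2 : ℝ) := by
    rw [← ENNReal.rpow_natCast, ← ENNReal.rpow_mul]
    simp
  -- Truncation and smoothing each get a budget η, and the squared triangle inequality doubles their
  -- sum.
  set η : ℝ≥0∞ := min (ε ^ 2) 1 / 4 with hη
  have hmin : 0 < min (ε ^ 2) 1 := lt_min (by positivity) one_pos
  have hηpos : 0 < η := ENNReal.div_pos hmin.ne' (by norm_num)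
  obtain ⟨n, hn⟩ := ((tendsto_tsum_weight_truncate hf).eventually_lt_const hηpos).exists
  set r : ℝ := 1 / ((n : ℝ) + 1) with hr
  have hrpos : 0 < r := by positivity
  set h : Γ.Point → ℂ := truncate r ∘ f with hh
  have hhH1 : ∀ e, IntervalH1 (Γ.length e) (Γ.onEdge h e) := fun e =>
    (hH1 e).truncate_comp (Γ.length_pos e).le hrpos
  have hdH1 : ∀ e, IntervalH1 (Γ.length e) (Γ.onEdge (f - h) e) := fun e => by
    refine ⟨(hH1 e).1.sub (hhH1 e).1, (memLp_congr_ae ?_).1 ((hH1 e).2.sub (hhH1 e).2)⟩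
    filter_upwards [(hH1 e).1.ae_differentiableAt_restrict (Γ.length_pos e).le,
      (hhH1 e).1.ae_differentiableAt_restrict (Γ.length_pos e).le] with t h1 h2
    exact (deriv_sub h1 h2).symm
  obtain ⟨δ, hδ, hδη⟩ := ENNReal.exists_pos_sum_of_countable' hηpos.ne' Γ.Edge
  -- It is f - h that gets smoothed: it vanishes wherever |f| ≤ r, hence outside finitely many edges
  -- by decay at infinity.
  obtain ⟨g, hg, hgδ⟩ := exists_mem_domPreminimal_approx hdH1
    (finite_edges_norm_sq_ge hends hf (pow_pos hrpos 2)) (fun e he t ht => by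
      have : ‖f (Γ.param e t)‖ ≤ r := by
        by_contra! hlt
        exact he ⟨t, ht, pow_le_pow_left₀ hrpos.le hlt.le 2⟩
      simp [hh, truncate_of_norm_le hrpos this]) hδ
  refine ⟨g, hg, ?_⟩
  rw [hεsq, h1Norm_lt_rpow]
  have hle : ∀ e, weight (f - g) e ≤ 2 * (weight h e + δ e) := by
    intro e
    have hsum : Γ.onEdge (f - g) e = Γ.onEdge h e + (Γ.onEdge (f - h) e - Γ.onEdge g e) := by
      funext t
      simp only [onEdge, Pi.add_apply, Pi.sub_apply]
      ring
    rw [weight, hsum]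
    refine (sobolevSq_add_le (Γ.length_pos e).le (hhH1 e).1
      ((hdH1 e).1.sub (hg.1 e).1.1)).trans ?_
    gcongr
    · exact le_rfl
    · exact hgδ e
  calc ∑' e, weight (f - g) e ≤ ∑' e, 2 * (weight h e + δ e) := ENNReal.tsum_le_tsum hle
    _ = 2 * (∑' e, weight h e + ∑' e, δ e) := by rw [ENNReal.tsum_mul_left, ENNReal.tsum_add]
    _ < 2 * (η + η) := by
        refine (ENNReal.mul_lt_mul_iff_right (by norm_num) (by norm_num)).2 ?_
        exact ENNReal.add_lt_add hn hδη
    _ = 4 * η := by ring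
    _ = min (ε ^ 2) 1 := ENNReal.mul_div_cancel (by norm_num) (by norm_num)
    _ ≤ ε ^ 2 := min_le_left _ _

end MetricGraph

end

theorem corollary3p10 {V : Type*} [Countable V] [Infinite V] (Γ : MetricGraph V) :
    Γ.H1 = Γ.H10 ↔ ∀ γ : Γ.TopEnd, γ.HasInfiniteVolume :=
  ⟨MetricGraph.hasInfiniteVolume_of_H1_eq_H10, MetricGraph.H1_eq_H10_of_hasInfiniteVolume⟩
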